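/- Let $\mathfrak A$ be a unital $*$-algebra (an associative unital complex algebra with an antilinear involution $^*$), let $a=a^*\in\mathfrak A$, and let $\omega:\mathfrak A\to\mathbb C$ be a non-normalized state, i.e. a linear functional with $\omega(b^*b)\ge 0$ for all $b\in\mathfrak A$ and $\omega(1)\neq 0$. Let $(\mathsf H_\omega,\mathcal D_\omega,\pi_\omega,\psi_\omega)$ be a GNS quadruple of $(\mathfrak A,\omega)$: $\mathsf H_\omega$ is a complex Hilbert space, $\mathcal D_\omega\subset\mathsf H_\omega$ a dense subspace, $\pi_\omega$ a unital algebra representation of $\mathfrak A$ by operators $\pi_\omega(b):\mathcal D_\omega\to\mathcal D_\omega$ with $\pi_\omega(b^*)\subset\pi_\omega(b)^\dagger$, and $\psi_\omega\in\mathcal D_\omega$ satisfies $\mathcal D_\omega=\pi_\omega(\mathfrak A)\psi_\omega$ and $\omega(b)=\langle\psi_\omega|\pi_\omega(b)\psi_\omega\rangle$ for all $b\in\mathfrak A$. A positive Borel measure $\mu$ on $\mathbb R$ is said to solve the moment problem for $(a,\omega)$ if, for every $n\in\mathbb N=\{0,1,2,\dots\}$, $\lambda^n$ is $\mu$-integrable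 and $$\omega(a^n)=\int_{\mathbb R}\lambda^n\,d\mu(\lambda).$$ (a) Suppose that $\pi_\omega(a)$ is essentially selfadjoint. Then its closure $\overline{\pi_\omega(a)}$ has a projection-valued spectral measure $P$ on the Borel sets of $\mathbb R$, that is, $\overline{\pi_\omega(a)}=\int_{\mathbb R}\lambda\,dP(\lambda)$; and for every such $P$ the measure $\mu^{(a)}_\omega(E):=\langle\psi_\omega|P(E)\psi_\omega\rangle$ is a finite positive Borel measure that solves the moment problem for $(a,\omega)$. (b) Suppose that $\mathfrak A$ is a unital $C^*$-algebra. Then $\pi_\omega(a)$ is essentially selfadjoint, and $\mu^{(a)}_\omega$ is the unique positive Borel measure on $\mathbb R$ that solves the moment problem for $(a,\omega)$. -/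

import Mathlib

open MeasureTheory
open scoped ComplexOrder InnerProductSpace

universe u v

noncomputable section

/-- A non-normalized state on a unital `*`-algebra: a linear functional `ω` with `ω (a* a) ≥ 0`
for all `a`, and `ω 1 ≠ 0`. -/
structure NonNormalizedState (A : Type u) [Ring A] [StarRing A] [Algebra ℂ A]
    extends A →ₗ[ℂ] ℂ where
  nonneg' : ∀ a : A, 0 ≤ toFun (star a * a)
  map_one_ne_zero' : toFun 1 ≠ 0

instance {A : Type u} [Ring A] [StarRing A] [Algebra ℂ A] :
    CoeFun (NonNormalizedState A) (fun _ => A → ℂ) :=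
  ⟨fun ω => ω.toLinearMap⟩

section Operators

variable {H : Type v} [NormedAddCommGroup H] [InnerProductSpace ℂ H]

/-- A linear map `D → D` regarded as an operator in `H` with domain `D`. -/
def operatorOn (D : Submodule ℂ H) (f : Module.End ℂ D) : H →ₗ.[ℂ] H where
  domain := D
  toFun := D.subtype ∘ₗ f

/-- A densely defined Hermitian operator. -/
structure IsSymmetricOperator (T : H →ₗ.[ℂ] H) : Prop where
  dense_domain : Dense (T.domain : Set H)
  hermitian : ∀ x y : T.domain, ⟪T x, (y : H)⟫_ℂ = ⟪(x : H), T y⟫_ℂ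

/-- A symmetric operator is essentially selfadjoint if its closure is selfadjoint. -/
structure IsEssentiallySelfAdjoint [CompleteSpace H] (T : H →ₗ.[ℂ] H) : Prop where
  symmetric : IsSymmetricOperator T
  closure_selfAdjoint : IsSelfAdjoint T.closure

end Operators

section GNS

variable {A : Type u} [Ring A] [StarRing A] [Algebra ℂ A]

/-- A GNS quadruple `(H, D, π, ψ)` of `(A, ω)`. -/
structure GNSQuadruple (ω : NonNormalizedState A)
    (H : Type v) [NormedAddCommGroup H] [InnerProductSpace ℂ H] [CompleteSpace H] where
  /-- the dense subspace `D` of the Hilbert space `H` -/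
  D : Submodule ℂ H
  dense_D : Dense (D : Set H)
  /-- the unital representation by operators `D → D` -/
  π : A →ₐ[ℂ] Module.End ℂ D
  /-- `π (a*) ⊆ π (a)†` -/
  star_le_adjoint : ∀ a : A, operatorOn D (π (star a)) ≤ (operatorOn D (π a)).adjoint
  /-- the cyclic vector -/
  ψ : D
  /-- `D = π (A) ψ` -/
  cyclic : ∀ x : D, ∃ a : A, π a ψ = x
  /-- `ω (a) = ⟨ψ | π (a) ψ⟩` -/
  expectation : ∀ a : A, ω a = ⟪(ψ : H), (π a ψ : H)⟫_ℂ

/-- The operator `π_ω (a)` in the Hilbert space `H`, with domain `D`. -/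
def GNSQuadruple.op {ω : NonNormalizedState A}
    {H : Type v} [NormedAddCommGroup H] [InnerProductSpace ℂ H] [CompleteSpace H]
    (Q : GNSQuadruple ω H) (a : A) : H →ₗ.[ℂ] H :=
  operatorOn Q.D (Q.π a)

/-- `μ` solves the moment problem for `(a, ω)`: for every `n` the `n`-th moment of the Borel
measure `μ` exists and equals `ω (a ^ n)`. The case `n = 0` forces `μ` to be finite. -/
structure SolvesMomentProblem (ω : NonNormalizedState A) (a : A) (μ : Measure ℝ) : Prop where
  integrable : ∀ n : ℕ, Integrable (fun t : ℝ => t ^ n) μ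
  moment : ∀ n : ℕ, ω (a ^ n) = ((∫ t : ℝ, t ^ n ∂μ : ℝ) : ℂ)

end GNS

section PVM

/-- A (normalized) projection-valued measure on the Borel sets of `ℝ`; only the values on Borel
sets matter. -/
structure PVM (H : Type v) [NormedAddCommGroup H] [InnerProductSpace ℂ H] [CompleteSpace H] where
  proj : Set ℝ → H →L[ℂ] H
  isProj : ∀ E, MeasurableSet E → IsStarProjection (proj E)
  univ : proj Set.univ = 1
  hasSum : ∀ E : ℕ → Set ℝ, (∀ n, MeasurableSet (E n)) → Pairwise (Function.onFun Disjoint E) →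
    ∀ x : H, HasSum (fun n => proj (E n) x) (proj (⋃ n, E n) x)

variable {H : Type v} [NormedAddCommGroup H] [InnerProductSpace ℂ H] [CompleteSpace H]

theorem PVM.empty (P : PVM H) (x : H) : P.proj ∅ x = 0 := by
  have h := P.hasSum (fun _ => ∅) (fun _ => MeasurableSet.empty)
    (fun _ _ _ => disjoint_bot_left) x
  exact tendsto_nhds_unique tendsto_const_nhds h.summable.tendsto_atTop_zero

theorem PVM.inner_eq (P : PVM H) {E : Set ℝ} (hE : MeasurableSet E) (x : H) :
    ⟪x, P.proj E x⟫_ℂ = ((‖P.proj E x‖ ^ 2 : ℝ) : ℂ) := by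
  have h := P.isProj E hE
  have h1 : P.proj E (P.proj E x) = P.proj E x :=
    congrArg (fun T : H →L[ℂ] H => T x) h.isIdempotentElem
  have h2 : ContinuousLinearMap.adjoint (P.proj E) = P.proj E := h.isSelfAdjoint
  have h3 : ⟪P.proj E x, P.proj E x⟫_ℂ = ⟪x, P.proj E x⟫_ℂ := by
    rw [← ContinuousLinearMap.adjoint_inner_right, h2, h1]
  rw [← h3, inner_self_eq_norm_sq_to_K]
  push_cast
  rfl

theorem PVM.re_inner_nonneg (P : PVM H) {E : Set ℝ} (hE : MeasurableSet E) (x : H) :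
    0 ≤ (⟪x, P.proj E x⟫_ℂ).re := by
  rw [P.inner_eq hE, Complex.ofReal_re]
  positivity

/-- The positive Borel measure `E ↦ ⟨x | P (E) x⟩`. -/
def PVM.measure (P : PVM H) (x : H) : Measure ℝ :=
  Measure.ofMeasurable (fun E _ => ENNReal.ofReal (⟪x, P.proj E x⟫_ℂ).re)
    (by simp [P.empty])
    (by
      intro E hE hd
      have h := (P.hasSum E hE hd x).mapL (innerSL ℂ x)
      have h' := h.mapL Complex.reCLM
      simp only [innerSL_apply_apply, Complex.reCLM_apply] at h'
      rw [← h'.tsum_eq]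
      exact ENNReal.ofReal_tsum_of_nonneg (fun n => P.re_inner_nonneg (hE n) x) h'.summable)

theorem PVM.measure_apply (P : PVM H) (x : H) {E : Set ℝ} (hE : MeasurableSet E) :
    P.measure x E = ENNReal.ofReal (⟪x, P.proj E x⟫_ℂ).re :=
  Measure.ofMeasurable_apply E hE

/-- `P` is a spectral measure of the operator `T`, i.e. `T = ∫ t dP(t)`: the domain of `T` is
`{x | ∫ t² d⟨x|P(t)x⟩ < ∞}`, and `⟨x|Tx⟩ = ∫ t d⟨x|P(t)x⟩` there (which, by polarization and
density of the domain, determines `T`). -/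
structure PVM.IsSpectralMeasureOf (P : PVM H) (T : H →ₗ.[ℂ] H) : Prop where
  mem_domain : ∀ x : H, x ∈ T.domain ↔ Integrable (fun t : ℝ => t ^ 2) (P.measure x)
  inner_apply : ∀ x : T.domain,
    ⟪(x : H), T x⟫_ℂ = ((∫ t : ℝ, t ∂(P.measure (x : H)) : ℝ) : ℂ)

end PVM

/-! The GNS construction: every non-normalized state has a GNS quadruple, on the completion of
`A / {a | ω (a* a) = 0}`. -/

namespace NonNormalizedState

variable {A : Type u} [Ring A] [StarRing A] [Algebra ℂ A]

theorem inner_symm [StarModule ℂ A] (ω : NonNormalizedState A) (a b : A) :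
    (starRingEnd ℂ) (ω (star b * a)) = ω (star a * b) := by
  have hq : ∀ x : A, (ω (star x * x)).im = 0 := fun x =>
    ((Complex.le_def.1 (ω.nonneg' x)).2).symm
  have h1 := hq (a + b)
  have h2 := hq (a + Complex.I • b)
  have ha := hq a
  have hb := hq b
  simp only [star_add, star_smul, mul_add, add_mul, smul_mul_assoc, mul_smul_comm, map_add,
    map_smul, Complex.star_def, Complex.conj_I, smul_eq_mul, Complex.add_im, Complex.mul_im,
    Complex.mul_re, Complex.neg_re, Complex.neg_im, Complex.I_re, Complex.I_im] at h1 h2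
  apply Complex.ext
  · simp only [Complex.conj_re]; linarith
  · simp only [Complex.conj_im]; linarith

/-- `A` with the semi-inner product `⟨a | b⟩ = ω (a* b)`. -/
@[nolint unusedArguments]
def PreGNS (_ω : NonNormalizedState A) : Type u := A

variable (ω : NonNormalizedState A)

instance : AddCommGroup ω.PreGNS := inferInstanceAs (AddCommGroup A)
instance : Module ℂ ω.PreGNS := inferInstanceAs (Module ℂ A)

/-- The identity map from `A` to `A` with its semi-inner product. -/
def toPreGNS : A ≃ₗ[ℂ] ω.PreGNS := LinearEquiv.refl ℂ _

variable [StarModule ℂ A]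

/-- The semi-inner product `⟨a | b⟩ = ω (a* b)`. -/
abbrev preGNSCore : PreInnerProductSpace.Core ℂ ω.PreGNS where
  inner a b := ω (star (ω.toPreGNS.symm a) * ω.toPreGNS.symm b)
  conj_inner_symm a b := ω.inner_symm _ _
  re_inner_nonneg a := (Complex.le_def.1 (ω.nonneg' (ω.toPreGNS.symm a))).1
  add_left _ _ _ := by rw [map_add, star_add, add_mul, map_add]
  smul_left := by simp

instance : SeminormedAddCommGroup ω.PreGNS :=
  InnerProductSpace.Core.toSeminormedAddCommGroup (c := ω.preGNSCore)
instance : InnerProductSpace ℂ ω.PreGNS :=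
  InnerProductSpace.ofCore ω.preGNSCore

theorem preGNS_inner (a b : A) :
    ⟪ω.toPreGNS a, ω.toPreGNS b⟫_ℂ = ω (star a * b) := rfl

/-- The GNS Hilbert space. -/
abbrev GNSSpace : Type u := UniformSpace.Completion ω.PreGNS

/-- The map `b ↦ [b]`. -/
def gnsClass : A →ₗ[ℂ] ω.GNSSpace :=
  (UniformSpace.Completion.toComplL (𝕜 := ℂ) (E := ω.PreGNS)).toLinearMap ∘ₗ
    ω.toPreGNS.toLinearMap

theorem gnsClass_inner (a b : A) : ⟪ω.gnsClass a, ω.gnsClass b⟫_ℂ = ω (star a * b) := by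
  rw [← preGNS_inner]
  exact UniformSpace.Completion.inner_coe _ _

theorem mul_mem_ker (a b : A) (hb : b ∈ LinearMap.ker ω.gnsClass) :
    a * b ∈ LinearMap.ker ω.gnsClass := by
  rw [LinearMap.mem_ker] at hb ⊢
  rw [← inner_self_eq_zero (𝕜 := ℂ), gnsClass_inner,
    show star (a * b) * (a * b) = star (star a * (a * b)) * b by simp [mul_assoc],
    ← gnsClass_inner, hb, inner_zero_right]

/-- `[b] ↦ [a b]`. -/
def gnsEnd (a : A) : Module.End ℂ (LinearMap.range ω.gnsClass) :=
  (ω.gnsClass.quotKerEquivRange).conj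
    ((LinearMap.ker ω.gnsClass).mapQ (LinearMap.ker ω.gnsClass) (LinearMap.mulLeft ℂ a)
      (fun b hb => ω.mul_mem_ker a b hb))

theorem gnsEnd_apply (a b : A) :
    ω.gnsEnd a (ω.gnsClass.rangeRestrict b) = ω.gnsClass.rangeRestrict (a * b) := by
  have h : ∀ c, ω.gnsClass.rangeRestrict c =
      ω.gnsClass.quotKerEquivRange (Submodule.Quotient.mk c) := fun c => Subtype.ext rfl
  rw [h, h, gnsEnd, LinearEquiv.conj_apply_apply, LinearEquiv.symm_apply_apply]
  rfl

/-- The GNS quadruple given by the GNS construction. -/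
def gnsQuadruple : GNSQuadruple ω ω.GNSSpace where
  D := LinearMap.range ω.gnsClass
  dense_D := by
    have : (LinearMap.range ω.gnsClass : Set ω.GNSSpace) =
        Set.range ((↑) : ω.PreGNS → ω.GNSSpace) := by
      ext x; exact Iff.rfl
    rw [this]
    exact UniformSpace.Completion.denseRange_coe
  π := AlgHom.ofLinearMap
    { toFun := ω.gnsEnd
      map_add' := fun a b => by
        ext ⟨_, c, rfl⟩ : 1
        change ω.gnsEnd (a + b) (ω.gnsClass.rangeRestrict c) =
          ω.gnsEnd a (ω.gnsClass.rangeRestrict c) + ω.gnsEnd b (ω.gnsClass.rangeRestrict c)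
        simp only [gnsEnd_apply, add_mul, map_add]
      map_smul' := fun r a => by
        ext ⟨_, c, rfl⟩ : 1
        change ω.gnsEnd (r • a) (ω.gnsClass.rangeRestrict c) =
          r • ω.gnsEnd a (ω.gnsClass.rangeRestrict c)
        simp only [gnsEnd_apply, smul_mul_assoc, map_smul] }
    (by
      ext ⟨_, c, rfl⟩ : 1
      change ω.gnsEnd 1 (ω.gnsClass.rangeRestrict c) = ω.gnsClass.rangeRestrict c
      rw [gnsEnd_apply, one_mul])
    (fun a b => by
      ext ⟨_, c, rfl⟩ : 1
      change ω.gnsEnd (a * b) (ω.gnsClass.rangeRestrict c) =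
        ω.gnsEnd a (ω.gnsEnd b (ω.gnsClass.rangeRestrict c))
      simp only [gnsEnd_apply, mul_assoc])
  star_le_adjoint := fun a => by
    refine LinearPMap.IsFormalAdjoint.le_adjoint ?_ ?_
    · change Dense (Set.range ((↑) : ω.PreGNS → ω.GNSSpace))
      exact UniformSpace.Completion.denseRange_coe
    · rintro ⟨_, b, rfl⟩ ⟨_, c, rfl⟩
      change ⟪(ω.gnsEnd a (ω.gnsClass.rangeRestrict b) : ω.GNSSpace), ω.gnsClass c⟫_ℂ =
        ⟪ω.gnsClass b, (ω.gnsEnd (star a) (ω.gnsClass.rangeRestrict c) : ω.GNSSpace)⟫_ℂ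
      rw [gnsEnd_apply, gnsEnd_apply]
      change ⟪ω.gnsClass (a * b), ω.gnsClass c⟫_ℂ = ⟪ω.gnsClass b, ω.gnsClass (star a * c)⟫_ℂ
      simp [gnsClass_inner, mul_assoc]
  ψ := ω.gnsClass.rangeRestrict 1
  cyclic := by
    rintro ⟨_, b, rfl⟩
    refine ⟨b, ?_⟩
    change ω.gnsEnd b (ω.gnsClass.rangeRestrict 1) = ω.gnsClass.rangeRestrict b
    rw [gnsEnd_apply, mul_one]
  expectation := fun a => by
    change ω a = ⟪ω.gnsClass 1, (ω.gnsEnd a (ω.gnsClass.rangeRestrict 1) : ω.GNSSpace)⟫_ℂ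
    rw [gnsEnd_apply]
    change ω a = ⟪ω.gnsClass 1, ω.gnsClass (a * 1)⟫_ℂ
    simp [gnsClass_inner]

end NonNormalizedState

end

/-
For a selfadjoint `T` the bounded operator `(T + i)⁻¹` is normal. Its continuous functional calculus
and the Riesz–Markov measures of its vectors give `L²` models of the cyclic subspaces, hence
projections indexed by the Borel sets of the spectrum; transporting them to `ℝ` along `z ↦ re z⁻¹`
gives a spectral measure of `T`.

For an arbitrary spectral measure `P` of `T`, polarization shows that `P` commutes with `T` and that
`d⟨Tx|P Tx⟩ = t² d⟨x|P x⟩`, so that `⟨ψ|π(aⁿ)ψ⟩` is the `n`-th moment of `⟨ψ|P ψ⟩`.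

In a C*-algebra `ω (b* a* a b) ≤ ‖a‖² ω (b* b)`, so `π(a)` is bounded and `|ω (aⁿ)|` is at most
`ω 1 ‖a‖ⁿ`. Hence a solution of the moment problem has compact support, its moment generating
function is entire, and it is determined by its moments.
-/

section IndicatorConstLp

open Filter Topology

theorem hasSum_indicatorConstLp {α G ι : Type*} [MeasurableSpace α] [NormedAddCommGroup G]
    [Countable ι] {μ : Measure α} [IsFiniteMeasure μ] {p : ENNReal} [Fact (1 ≤ p)] (hp : p ≠ ⊤)
    {E : ι → Set α} (hE : ∀ i, MeasurableSet (E i)) (hd : Pairwise (Function.onFun Disjoint E))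
    (c : G) :
    HasSum (fun i => indicatorConstLp p (hE i) (measure_ne_top μ _) c)
      (indicatorConstLp p (MeasurableSet.iUnion hE) (measure_ne_top μ _) c) := by
  classical
  have hsum (s : Finset ι) : ∑ i ∈ s, indicatorConstLp p (hE i) (measure_ne_top μ _) c =
      indicatorConstLp p (s.measurableSet_biUnion fun i _ => hE i) (measure_ne_top μ _) c := by
    induction s using Finset.induction_on with
    | empty => simp
    | insert i s hi ih =>
      have hdis : Disjoint (E i) (⋃ j ∈ s, E j) :=
        Set.disjoint_iUnion₂_right.2 fun j hj => hd fun hij => hi (hij ▸ hj)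
      simp only [Finset.set_biUnion_insert]
      rw [Finset.sum_insert hi, ih, indicatorConstLp_disjoint_union _ _ _ _ hdis]
  have htail (s : Finset ι) :
      μ (symmDiff (⋃ i ∈ s, E i) (⋃ i, E i)) ≤ ∑' i : {i // i ∉ s}, μ (E i) := by
    refine (measure_mono ?_).trans (measure_iUnion_le _)
    rintro t (⟨ht, ht'⟩ | ⟨ht, ht'⟩)
    · exact absurd (Set.iUnion₂_subset_iUnion _ _ ht) ht'
    · obtain ⟨i, hi⟩ := Set.mem_iUnion.1 ht
      exact Set.mem_iUnion.2 ⟨⟨i, fun his => ht' (Set.mem_biUnion his hi)⟩, hi⟩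
  have hfinite : ∑' i, μ (E i) ≠ ⊤ := by
    rw [← measure_iUnion hd hE]
    exact measure_ne_top _ _
  rw [HasSum, SummationFilter.unconditional_filter]
  simp_rw [hsum]
  exact tendsto_indicatorConstLp_set hp (tendsto_of_tendsto_of_tendsto_of_le_of_le
    tendsto_const_nhds (ENNReal.tendsto_tsum_compl_atTop_zero hfinite) (fun _ => zero_le) htail)

end IndicatorConstLp

noncomputable section FunctionalCalculus

open Filter Topology

variable {H : Type v} [NormedAddCommGroup H] [InnerProductSpace ℂ H] [CompleteSpace H]
  {X : Type*} [MetricSpace X] (Φ : C(X, ℂ) →⋆ₐ[ℂ] (H →L[ℂ] H))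

theorem inner_apply_star_mul_self (f : C(X, ℂ)) (x : H) :
    ⟪x, Φ (star f * f) x⟫_ℂ = ((‖Φ f x‖ ^ 2 : ℝ) : ℂ) := by
  rw [map_mul, map_star, mul_apply_eq_comp, ContinuousLinearMap.star_eq_adjoint,
    ContinuousLinearMap.adjoint_inner_right, inner_self_eq_norm_sq_to_K]
  norm_cast

/-- A real-valued continuous function regarded as a complex-valued one. -/
def ofRealMap : C(X, ℝ) →L[ℝ] C(X, ℂ) :=
  Complex.ofRealCLM.compLeftContinuous ℝ X

@[simp]
theorem ofRealMap_apply (g : C(X, ℝ)) (t : X) : ofRealMap g t = (g t : ℂ) :=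
  rfl

theorem im_inner_apply_ofRealMap (g : C(X, ℝ)) (x : H) :
    (⟪x, Φ (ofRealMap g) x⟫_ℂ).im = 0 := by
  have hg : IsSelfAdjoint (ofRealMap g) := by
    ext t
    simp
  exact (hg.map Φ).isSymmetric.im_inner_self_apply x

variable [CompactSpace X] [MeasurableSpace X] [BorelSpace X]

/-- The positive functional `g ↦ ⟨x | Φ (g) x⟩`. -/
def cyclicFunctional (x : H) : CompactlySupportedContinuousMap X ℝ →ₚ[ℝ] ℝ :=
  PositiveLinearMap.mk₀
    { toFun := fun g => (⟪x, Φ (ofRealMap (g : C(X, ℝ))) x⟫_ℂ).re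
      map_add' := fun g g' => by
        change (⟪x, Φ (ofRealMap ((g : C(X, ℝ)) + (g' : C(X, ℝ)))) x⟫_ℂ).re = _
        simp
      map_smul' := fun c g => by
        change (⟪x, Φ (ofRealMap (c • (g : C(X, ℝ)))) x⟫_ℂ).re = _
        rw [map_smul, ← Complex.coe_smul, map_smul]
        simp }
    (by
      intro g hg
      let s : C(X, ℝ) := ⟨fun t => √(g t), by fun_prop⟩
      have hs : ofRealMap (g : C(X, ℝ)) = star (ofRealMap s) * ofRealMap s := by
        ext t
        have := Real.mul_self_sqrt (hg t)
        simp [s, ← Complex.ofReal_mul, this]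
      change 0 ≤ (⟪x, Φ (ofRealMap (g : C(X, ℝ))) x⟫_ℂ).re
      rw [hs, inner_apply_star_mul_self, Complex.ofReal_re]
      positivity)

/-- The cyclic measure of `x`: the measure `μ` on `X` with `⟨x | Φ (f) x⟩ = ∫ f dμ`, which exists
by the Riesz–Markov–Kakutani theorem. -/
def cyclicMeasure (x : H) : Measure X :=
  RealRMK.rieszMeasure (cyclicFunctional Φ x)

instance (x : H) : IsFiniteMeasure (cyclicMeasure Φ x) :=
  inferInstanceAs (IsFiniteMeasure (RealRMK.rieszMeasure _))

theorem integrable_continuousMap {E : Type*} [NormedAddCommGroup E]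
    (μ : Measure X) [IsFiniteMeasure μ] (f : C(X, E)) : Integrable f μ :=
  (map_continuous f).integrable_of_hasCompactSupport (HasCompactSupport.of_compactSpace f)

theorem inner_apply_ofRealMap (x : H) (g : C(X, ℝ)) :
    ⟪x, Φ (ofRealMap g) x⟫_ℂ = ((∫ t, g t ∂(cyclicMeasure Φ x) : ℝ) : ℂ) := by
  refine Complex.ext ?_ (im_inner_apply_ofRealMap Φ g x)
  exact (RealRMK.integral_rieszMeasure (cyclicFunctional Φ x)
    (CompactlySupportedContinuousMap.continuousMapEquiv g)).symm

theorem inner_apply_eq_integral (x : H) (f : C(X, ℂ)) :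
    ⟪x, Φ f x⟫_ℂ = ∫ t, f t ∂(cyclicMeasure Φ x) := by
  let r : C(X, ℝ) := ⟨fun t => (f t).re, by fun_prop⟩
  let i : C(X, ℝ) := ⟨fun t => (f t).im, by fun_prop⟩
  have hf : f = ofRealMap r + Complex.I • ofRealMap i := by
    ext t
    simp [r, i, mul_comm Complex.I]
  conv_lhs => rw [hf]
  rw [map_add, map_smul, add_apply, smul_apply, inner_add_right, inner_smul_right,
    inner_apply_ofRealMap, inner_apply_ofRealMap, mul_comm]
  exact integral_re_add_im (integrable_continuousMap _ f)

theorem norm_apply_eq_norm_toLp (x : H) (f : C(X, ℂ)) :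
    ‖Φ f x‖ = ‖ContinuousMap.toLp 2 (cyclicMeasure Φ x) ℂ f‖ := by
  rw [← sq_eq_sq₀ (norm_nonneg _) (norm_nonneg _)]
  apply Complex.ofReal_injective
  have h := inner_self_eq_norm_sq_to_K (𝕜 := ℂ) (ContinuousMap.toLp 2 (cyclicMeasure Φ x) ℂ f)
  rw [ContinuousMap.inner_toLp] at h
  rw [← inner_apply_star_mul_self, inner_apply_eq_integral, Complex.ofReal_pow]
  refine Eq.trans ?_ h
  simp [mul_comm]

theorem cyclicMeasure_apply (x : H) (f : C(X, ℂ)) :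
    cyclicMeasure Φ (Φ f x) =
      (cyclicMeasure Φ x).withDensity fun t => ENNReal.ofReal (‖f t‖ ^ 2) := by
  have hf : IsFiniteMeasure
      ((cyclicMeasure Φ x).withDensity fun t => ENNReal.ofReal (‖f t‖ ^ 2)) :=
    isFiniteMeasure_withDensity_ofReal
      (integrable_continuousMap _ (⟨fun t => ‖f t‖ ^ 2, by fun_prop⟩ : C(X, ℝ))).2
  refine ext_of_forall_integral_eq_of_IsFiniteMeasure fun g => ?_
  rw [integral_withDensity_eq_integral_toReal_smul (by fun_prop) (by simp)]
  apply Complex.ofReal_injective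
  calc ((∫ t, g t ∂(cyclicMeasure Φ (Φ f x)) : ℝ) : ℂ)
      = ⟪Φ f x, Φ (ofRealMap g.toContinuousMap) (Φ f x)⟫_ℂ :=
        (inner_apply_ofRealMap Φ (Φ f x) g.toContinuousMap).symm
    _ = ⟪x, Φ (star f * (ofRealMap g.toContinuousMap * f)) x⟫_ℂ := by
        rw [← ContinuousLinearMap.adjoint_inner_right, ← ContinuousLinearMap.star_eq_adjoint,
          ← map_star, map_mul, map_mul]
        rfl
    _ = _ := by
        rw [inner_apply_eq_integral, ← integral_complex_ofReal]
        congr with t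
        simp only [ContinuousMap.mul_apply, ContinuousMap.star_apply, ofRealMap_apply,
          ENNReal.toReal_ofReal (sq_nonneg ‖f t‖), smul_eq_mul, Complex.ofReal_mul,
          Complex.ofReal_pow, ← Complex.conj_mul', Complex.star_def]
        change _ * ((g t : ℂ) * _) = _
        ring

/-- The linear map `f ↦ Φ (f) x`. -/
def orbitMap (x : H) : C(X, ℂ) →ₗ[ℂ] H :=
  (ContinuousLinearMap.apply ℂ H x).toLinearMap ∘ₗ Φ.toAlgHom.toLinearMap

theorem orbitMap_extendOfNorm_toLp (x : H) (f : C(X, ℂ)) :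
    (orbitMap Φ x).extendOfNorm
      (ContinuousMap.toLp (E := ℂ) 2 (cyclicMeasure Φ x) ℂ).toLinearMap
      (ContinuousMap.toLp 2 (cyclicMeasure Φ x) ℂ f) = Φ f x := by
  have hdense : DenseRange (ContinuousMap.toLp (E := ℂ) 2 (cyclicMeasure Φ x) ℂ).toLinearMap :=
    ContinuousMap.toLp_denseRange ℂ _ ℂ (by simp)
  have hnorm (g : C(X, ℂ)) : ‖orbitMap Φ x g‖ ≤
      1 * ‖(ContinuousMap.toLp (E := ℂ) 2 (cyclicMeasure Φ x) ℂ).toLinearMap g‖ := by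
    rw [one_mul]
    exact (norm_apply_eq_norm_toLp Φ x g).le
  exact (LinearMap.extendOfNorm_eq hdense ⟨1, hnorm⟩ f).trans rfl

/-- The isometry of `L²(μ_x)` into `H`, with `μ_x` the cyclic measure of `x`, that extends
`f ↦ Φ (f) x` from continuous to square integrable functions. -/
def cyclicIsometry (x : H) : Lp ℂ 2 (cyclicMeasure Φ x) →ₗᵢ[ℂ] H where
  toLinearMap := (orbitMap Φ x).extendOfNorm
    (ContinuousMap.toLp (E := ℂ) 2 (cyclicMeasure Φ x) ℂ).toLinearMap
  norm_map' := fun g => by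
    have hdense := ContinuousMap.toLp_denseRange (p := 2) ℂ (cyclicMeasure Φ x) ℂ (by simp)
    refine hdense.induction_on g (isClosed_eq ?_ continuous_norm) fun f => ?_
    · exact (ContinuousLinearMap.continuous _).norm
    · rw [← norm_apply_eq_norm_toLp]
      exact congrArg norm (orbitMap_extendOfNorm_toLp Φ x f)

theorem cyclicIsometry_toLp (x : H) (f : C(X, ℂ)) :
    cyclicIsometry Φ x (ContinuousMap.toLp 2 (cyclicMeasure Φ x) ℂ f) = Φ f x :=
  orbitMap_extendOfNorm_toLp Φ x f

theorem cyclicIsometry_indicator_univ (x : H) :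
    cyclicIsometry Φ x (indicatorConstLp 2 MeasurableSet.univ (measure_ne_top _ _) 1) = x := by
  have h := cyclicIsometry_toLp Φ x 1
  rw [map_one Φ, one_apply_eq_self] at h
  rwa [indicatorConstLp_univ]

theorem apply_cyclicIsometry (x : H) (f : C(X, ℂ)) {g k : Lp ℂ 2 (cyclicMeasure Φ x)}
    (hk : ∀ᵐ t ∂(cyclicMeasure Φ x), k t = f t * g t) :
    Φ f (cyclicIsometry Φ x g) = cyclicIsometry Φ x k := by
  let F : Lp ℂ ⊤ (cyclicMeasure Φ x) := ContinuousMap.toLp ⊤ (cyclicMeasure Φ x) ℂ f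
  let M := (ContinuousLinearMap.mul ℂ ℂ).holderL (cyclicMeasure Φ x) ⊤ 2 2 F
  have hM (g) : M g =ᵐ[cyclicMeasure Φ x] fun t => f t * g t := by
    filter_upwards [(ContinuousLinearMap.mul ℂ ℂ).coeFn_holder (r := 2) F g,
      ContinuousMap.coeFn_toLp (p := ⊤) (𝕜 := ℂ) (cyclicMeasure Φ x) f] with t hMt hFt
    exact hMt.trans (by rw [ContinuousLinearMap.mul_apply', hFt])
  suffices h : Φ f (cyclicIsometry Φ x g) = cyclicIsometry Φ x (M g) by
    rw [h, Lp.ext ((hM g).trans (hk.mono fun t ht => ht.symm))]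
  have hdense := ContinuousMap.toLp_denseRange (p := 2) ℂ (cyclicMeasure Φ x) ℂ (by simp)
  refine hdense.induction_on g (isClosed_eq ?_ ?_) fun u => ?_
  · exact (Φ f).continuous.comp (cyclicIsometry Φ x).continuous
  · exact (cyclicIsometry Φ x).continuous.comp M.continuous
  · have hu : M (ContinuousMap.toLp 2 (cyclicMeasure Φ x) ℂ u) =
        ContinuousMap.toLp 2 (cyclicMeasure Φ x) ℂ (f * u) := by
      refine Lp.ext ?_
      filter_upwards [hM (ContinuousMap.toLp 2 (cyclicMeasure Φ x) ℂ u),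
        ContinuousMap.coeFn_toLp (p := 2) (𝕜 := ℂ) (cyclicMeasure Φ x) u,
        ContinuousMap.coeFn_toLp (p := 2) (𝕜 := ℂ) (cyclicMeasure Φ x) (f * u)] with t h₁ h₂ h₃
      rw [h₁, h₂, h₃, ContinuousMap.mul_apply]
    rw [hu, cyclicIsometry_toLp, cyclicIsometry_toLp, map_mul, mul_apply_eq_comp]

/-- The vector `P(E) x`, where `P` is the spectral measure of `Φ`. -/
def spectralVector {E : Set X} (hE : MeasurableSet E) (x : H) : H :=
  cyclicIsometry Φ x (indicatorConstLp 2 hE (measure_ne_top _ _) 1)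

variable {E : Set X} (hE : MeasurableSet E)

theorem inner_self_spectralVector (x : H) :
    ⟪x, spectralVector Φ hE x⟫_ℂ = ((cyclicMeasure Φ x).real E : ℂ) := by
  nth_rw 1 [← cyclicIsometry_indicator_univ Φ x]
  rw [spectralVector, LinearIsometry.inner_map_map,
    L2.inner_indicatorConstLp_one_indicatorConstLp_one, Set.univ_inter]
  rfl

theorem measureReal_univ_cyclicMeasure (x : H) : (cyclicMeasure Φ x).real Set.univ = ‖x‖ ^ 2 := by
  have h := inner_self_spectralVector Φ MeasurableSet.univ x
  rw [spectralVector, cyclicIsometry_indicator_univ, inner_self_eq_norm_sq_to_K] at h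
  apply Complex.ofReal_injective
  rw [← h]
  norm_cast

theorem norm_sq_spectralVector (x : H) :
    ‖spectralVector Φ hE x‖ ^ 2 = (cyclicMeasure Φ x).real E := by
  have h := inner_self_eq_norm_sq_to_K (𝕜 := ℂ) (spectralVector Φ hE x)
  rw [spectralVector, LinearIsometry.inner_map_map,
    L2.inner_indicatorConstLp_one_indicatorConstLp_one, Set.inter_self] at h
  exact_mod_cast h.symm

theorem exists_seq_tendsto_spectralVector (s : Finset H) :
    ∃ f : ℕ → C(X, ℂ), ∀ x ∈ s,
      Tendsto (fun n => Φ (f n) x) atTop (𝓝 (spectralVector Φ hE x)) := by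
  let ν : Measure X := ∑ x ∈ s, cyclicMeasure Φ x
  have hν : MemLp (E.indicator fun _ => (1 : ℂ)) 2 ν :=
    memLp_indicator_const 2 hE 1 (Or.inr (measure_ne_top _ _))
  have happrox (n : ℕ) : ∃ f : C(X, ℂ),
      eLpNorm ((E.indicator fun _ => (1 : ℂ)) - (f : X → ℂ)) 2 ν ≤ (n : ENNReal)⁻¹ := by
    obtain ⟨f, hf, -⟩ := hν.exists_boundedContinuous_eLpNorm_sub_le (by simp)
      (ENNReal.inv_ne_zero.2 (ENNReal.natCast_ne_top n))
    exact ⟨f.toContinuousMap, hf⟩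
  choose f hf using happrox
  refine ⟨f, fun x hx => ?_⟩
  simp_rw [← cyclicIsometry_toLp]
  refine ((cyclicIsometry Φ x).continuous.tendsto _).comp ?_
  rw [tendsto_iff_edist_tendsto_0]
  refine tendsto_of_tendsto_of_tendsto_of_le_of_le tendsto_const_nhds
    ENNReal.tendsto_inv_nat_nhds_zero (fun _ => zero_le) fun n => ?_
  rw [edist_comm]
  have hle : cyclicMeasure Φ x ≤ ν := Finset.single_le_sum (fun _ _ => Measure.zero_le _) hx
  refine le_trans (le_of_eq ?_) ((eLpNorm_mono_measure _ hle).trans (hf n))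
  rw [Lp.edist_def]
  exact eLpNorm_congr_ae (indicatorConstLp_coeFn.sub (ContinuousMap.coeFn_toLp _ _))

theorem spectralVector_add (x y : H) :
    spectralVector Φ hE (x + y) = spectralVector Φ hE x + spectralVector Φ hE y := by
  classical
  obtain ⟨f, hf⟩ := exists_seq_tendsto_spectralVector Φ hE {x, y, x + y}
  refine tendsto_nhds_unique (hf (x + y) (by simp)) ?_
  simpa only [map_add] using (hf x (by simp)).add (hf y (by simp))

theorem spectralVector_smul (c : ℂ) (x : H) :
    spectralVector Φ hE (c • x) = c • spectralVector Φ hE x := by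
  classical
  obtain ⟨f, hf⟩ := exists_seq_tendsto_spectralVector Φ hE {x, c • x}
  refine tendsto_nhds_unique (hf (c • x) (by simp)) ?_
  simpa only [map_smul] using (hf x (by simp)).const_smul c

theorem norm_spectralVector_le (x : H) : ‖spectralVector Φ hE x‖ ≤ ‖x‖ := by
  rw [← sq_le_sq₀ (norm_nonneg _) (norm_nonneg _), norm_sq_spectralVector,
    ← measureReal_univ_cyclicMeasure Φ]
  exact measureReal_mono (Set.subset_univ E)

/-- The projection `P(E)`, where `P` is the spectral measure of `Φ`. -/
def spectralProjection : H →L[ℂ] H :=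
  LinearMap.mkContinuous
    { toFun := spectralVector Φ hE
      map_add' := spectralVector_add Φ hE
      map_smul' := spectralVector_smul Φ hE }
    1 fun x => by simpa using norm_spectralVector_le Φ hE x

theorem isStarProjection_of_inner_self_eq_norm_sq {P : H →L[ℂ] H}
    (h : ∀ x, ⟪x, P x⟫_ℂ = ((‖P x‖ ^ 2 : ℝ) : ℂ)) : IsStarProjection P := by
  have hstar : star P * P = P := by
    apply ContinuousLinearMap.coe_injective
    rw [← ext_inner_map]
    intro x
    have hx : ⟪P x, x⟫_ℂ = ((‖P x‖ ^ 2 : ℝ) : ℂ) := by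
      rw [← inner_conj_symm, h, Complex.conj_ofReal]
    change ⟪ContinuousLinearMap.adjoint P (P x), x⟫_ℂ = ⟪P x, x⟫_ℂ
    rw [ContinuousLinearMap.adjoint_inner_left, hx, inner_self_eq_norm_sq_to_K]
    norm_cast
  have hself : IsSelfAdjoint P := hstar ▸ IsSelfAdjoint.star_mul_self P
  rw [hself.star_eq] at hstar
  exact ⟨hstar, hself⟩

theorem isStarProjection_spectralProjection : IsStarProjection (spectralProjection Φ hE) :=
  isStarProjection_of_inner_self_eq_norm_sq fun x =>
    (inner_self_spectralVector Φ hE x).trans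
      (congrArg _ (norm_sq_spectralVector Φ hE x).symm)

/-- The projection-valued measure `F ↦ P(φ⁻¹(F))` on `ℝ`, where `P` is the spectral measure
of `Φ`. -/
def spectralPVM {φ : X → ℝ} (hφ : Measurable φ) : PVM H where
  proj F := by
    classical exact if hF : MeasurableSet F then spectralProjection Φ (hφ hF) else 0
  isProj F hF := by
    simpa only [hF, ↓reduceDIte] using isStarProjection_spectralProjection Φ (hφ hF)
  univ := by
    ext x
    simp only [MeasurableSet.univ, ↓reduceDIte]
    exact cyclicIsometry_indicator_univ Φ x
  hasSum F hF hd x := by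
    simp only [hF, MeasurableSet.iUnion hF, ↓reduceDIte]
    have h := (hasSum_indicatorConstLp (p := 2) (μ := cyclicMeasure Φ x) (by simp)
      (fun n => hφ (hF n)) (fun m n hmn => (hd hmn).preimage φ) (1 : ℂ)).mapL
      (cyclicIsometry Φ x).toContinuousLinearMap
    simp only [← Set.preimage_iUnion] at h
    exact h

theorem spectralPVM_measure {φ : X → ℝ} (hφ : Measurable φ) (x : H) :
    (spectralPVM Φ hφ).measure x = (cyclicMeasure Φ x).map φ := by
  ext F hF
  have hproj : (spectralPVM Φ hφ).proj F x = spectralVector Φ (hφ hF) x := by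
    simp only [spectralPVM, hF, ↓reduceDIte]
    rfl
  rw [PVM.measure_apply _ _ hF, hproj, inner_self_spectralVector, Complex.ofReal_re,
    ofReal_measureReal, Measure.map_apply hφ hF]

end FunctionalCalculus

noncomputable section Resolvent

variable {H : Type v} [NormedAddCommGroup H] [InnerProductSpace ℂ H] {T : H →ₗ.[ℂ] H}

/-- The map `(x, T x) ↦ T x + i x` on the graph of `T`. -/
def addIOnGraph (T : H →ₗ.[ℂ] H) : T.graph →L[ℂ] H :=
  (ContinuousLinearMap.snd ℂ H H + Complex.I • ContinuousLinearMap.fst ℂ H H).comp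
    T.graph.subtypeL

theorem IsSymmetricOperator.norm_sq_addIOnGraph (hT : IsSymmetricOperator T) (p : T.graph) :
    ‖addIOnGraph T p‖ ^ 2 = ‖(p : H × H).2‖ ^ 2 + ‖(p : H × H).1‖ ^ 2 := by
  obtain ⟨x, hx, hTx⟩ := (LinearPMap.mem_graph_iff _).1 p.2
  have hreal : (⟪T x, (x : H)⟫_ℂ).im = 0 := by
    rw [← Complex.conj_eq_iff_im, inner_conj_symm, hT.hermitian]
  change ‖(p : H × H).2 + Complex.I • (p : H × H).1‖ ^ 2 = _
  rw [← hx, ← hTx, @norm_add_sq ℂ, inner_smul_right, norm_smul]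
  simp [hreal]

theorem IsSymmetricOperator.antilipschitzWith_addIOnGraph (hT : IsSymmetricOperator T) :
    AntilipschitzWith 1 (addIOnGraph T) := by
  refine (addIOnGraph T).antilipschitz_of_bound fun p => ?_
  rw [NNReal.coe_one, one_mul]
  have h := hT.norm_sq_addIOnGraph p
  exact max_le
    (le_of_sq_le_sq (by rw [h]; exact le_add_of_nonneg_left (sq_nonneg _)) (norm_nonneg _))
    (le_of_sq_le_sq (by rw [h]; exact le_add_of_nonneg_right (sq_nonneg _)) (norm_nonneg _))

variable [CompleteSpace H]

theorem isSymmetricOperator_of_isSelfAdjoint (hT : IsSelfAdjoint T) : IsSymmetricOperator T where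
  dense_domain := hT.dense_domain
  hermitian := by
    have h := LinearPMap.adjoint_isFormalAdjoint hT.dense_domain
    rwa [LinearPMap.isSelfAdjoint_def.1 hT] at h

theorem exists_apply_eq_of_isSelfAdjoint (hT : IsSelfAdjoint T) {y w : H}
    (h : ∀ x : T.domain, ⟪w, (x : H)⟫_ℂ = ⟪y, T x⟫_ℂ) : ∃ hy : y ∈ T.domain, T ⟨y, hy⟩ = w := by
  suffices ∀ S : H →ₗ.[ℂ] H, S = T.adjoint → ∃ hy : y ∈ S.domain, S ⟨y, hy⟩ = w from
    this T (LinearPMap.isSelfAdjoint_def.1 hT).symm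
  rintro S rfl
  have hy := LinearPMap.mem_adjoint_domain_of_exists (T := T) y ⟨w, h⟩
  exact ⟨hy, LinearPMap.adjoint_apply_eq hT.dense_domain ⟨y, hy⟩ h⟩

theorem ker_addIOnGraph (hT : IsSelfAdjoint T) : (addIOnGraph T).ker = ⊥ :=
  LinearMap.ker_eq_bot.2
    (isSymmetricOperator_of_isSelfAdjoint hT).antilipschitzWith_addIOnGraph.injective

theorem range_addIOnGraph (hT : IsSelfAdjoint T) : (addIOnGraph T).range = ⊤ := by
  have : CompleteSpace T.graph := hT.isClosed.completeSpace_coe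
  have hclosed : IsClosed ((addIOnGraph T).range : Set H) :=
    (isSymmetricOperator_of_isSelfAdjoint hT).antilipschitzWith_addIOnGraph.isClosed_range
      (addIOnGraph T).uniformContinuous
  have : CompleteSpace (addIOnGraph T).range := hclosed.completeSpace_coe
  rw [← Submodule.orthogonal_eq_bot_iff, Submodule.eq_bot_iff]
  intro v hv
  have hv' (x : T.domain) : ⟪v, T x + Complex.I • (x : H)⟫_ℂ = 0 :=
    (Submodule.mem_orthogonal' _ _).1 hv _ ⟨⟨_, T.mem_graph x⟩, rfl⟩
  -- `v` is an eigenvector of `T` for the eigenvalue `i`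
  obtain ⟨hvT, hTv⟩ := exists_apply_eq_of_isSelfAdjoint hT (y := v) (w := Complex.I • v)
    fun x => by
      rw [inner_smul_left, Complex.conj_I]
      linear_combination (norm := (rw [inner_add_right, inner_smul_right]; ring)) -hv' x
  have h := hv' ⟨v, hvT⟩
  rw [hTv, ← two_smul ℂ, inner_smul_right, inner_smul_right] at h
  simpa using h

/-- The resolvent `(T + i)⁻¹` of a selfadjoint operator `T`. -/
def resolventI (hT : IsSelfAdjoint T) : H →L[ℂ] H :=
  have : CompleteSpace T.graph := hT.isClosed.completeSpace_coe
  (ContinuousLinearMap.fst ℂ H H ∘L T.graph.subtypeL) ∘L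
    (ContinuousLinearEquiv.ofBijective (addIOnGraph T) (ker_addIOnGraph hT)
      (range_addIOnGraph hT)).symm.toContinuousLinearMap

theorem resolventI_apply (hT : IsSelfAdjoint T) (x : T.domain) :
    resolventI hT (T x + Complex.I • (x : H)) = x := by
  have : CompleteSpace T.graph := hT.isClosed.completeSpace_coe
  exact congrArg (fun p : T.graph => (p : H × H).1)
    (ContinuousLinearEquiv.ofBijective_symm_apply_apply (addIOnGraph T) (ker_addIOnGraph hT)
      (range_addIOnGraph hT) ⟨_, T.mem_graph x⟩)

theorem exists_apply_resolventI (hT : IsSelfAdjoint T) (y : H) :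
    ∃ h : resolventI hT y ∈ T.domain, T ⟨resolventI hT y, h⟩ = y - Complex.I • resolventI hT y := by
  obtain ⟨p, rfl⟩ := LinearMap.range_eq_top.1 (range_addIOnGraph hT) y
  obtain ⟨x, hx, hTx⟩ := (LinearPMap.mem_graph_iff _).1 p.2
  have hp : addIOnGraph T p = T x + Complex.I • (x : H) := by
    rw [hx, hTx]
    rfl
  change ∃ h : resolventI hT (addIOnGraph T p) ∈ T.domain, T ⟨resolventI hT (addIOnGraph T p), h⟩ =
    addIOnGraph T p - Complex.I • resolventI hT (addIOnGraph T p)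
  simp only [hp, resolventI_apply, add_sub_cancel_right, Subtype.coe_eta, SetLike.coe_mem,
    exists_const]

theorem resolventI_injective (hT : IsSelfAdjoint T) : Function.Injective (resolventI hT) := by
  rw [injective_iff_map_eq_zero]
  intro y hy
  obtain ⟨h, hTy⟩ := exists_apply_resolventI hT y
  have h0 : (⟨resolventI hT y, h⟩ : T.domain) = 0 := Subtype.ext hy
  rw [h0, LinearPMap.map_zero, hy, smul_zero, sub_zero] at hTy
  exact hTy.symm

theorem exists_apply_star_resolventI (hT : IsSelfAdjoint T) (y : H) :
    ∃ h : star (resolventI hT) y ∈ T.domain,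
      T ⟨star (resolventI hT) y, h⟩ = y + Complex.I • star (resolventI hT) y := by
  refine exists_apply_eq_of_isSelfAdjoint hT fun x => ?_
  have h : ⟪star (resolventI hT) y, T x + Complex.I • (x : H)⟫_ℂ = ⟪y, (x : H)⟫_ℂ := by
    rw [ContinuousLinearMap.star_eq_adjoint, ContinuousLinearMap.adjoint_inner_left,
      resolventI_apply]
  rw [inner_add_right, inner_smul_right] at h
  rw [inner_add_left, inner_smul_left, Complex.conj_I]
  linear_combination -h

theorem star_resolventI_apply (hT : IsSelfAdjoint T) (x : T.domain) :
    star (resolventI hT) (T x - Complex.I • (x : H)) = x := by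
  refine ext_inner_right ℂ fun y => ?_
  obtain ⟨h, hTy⟩ := exists_apply_resolventI hT y
  have hs := (isSymmetricOperator_of_isSelfAdjoint hT).hermitian x ⟨_, h⟩
  rw [hTy, inner_sub_right, inner_smul_right] at hs
  rw [ContinuousLinearMap.star_eq_adjoint, ContinuousLinearMap.adjoint_inner_left, inner_sub_left,
    inner_smul_left, Complex.conj_I]
  linear_combination hs

theorem star_resolventI_sub (hT : IsSelfAdjoint T) :
    star (resolventI hT) - resolventI hT =
      (2 * Complex.I) • (star (resolventI hT) * resolventI hT) := by
  ext y
  obtain ⟨h, hTy⟩ := exists_apply_resolventI hT y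
  have hR : star (resolventI hT) (T ⟨_, h⟩ - Complex.I • resolventI hT y) = resolventI hT y :=
    star_resolventI_apply hT ⟨_, h⟩
  rw [hTy, map_sub, map_sub, map_smul] at hR
  simp only [sub_apply, smul_apply, mul_apply_eq_comp]
  linear_combination (norm := module) hR

theorem star_resolventI_sub' (hT : IsSelfAdjoint T) :
    star (resolventI hT) - resolventI hT =
      (2 * Complex.I) • (resolventI hT * star (resolventI hT)) := by
  ext y
  obtain ⟨h, hTy⟩ := exists_apply_star_resolventI hT y
  have hR : resolventI hT (T ⟨_, h⟩ + Complex.I • star (resolventI hT) y) =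
    star (resolventI hT) y := resolventI_apply hT ⟨_, h⟩
  rw [hTy, map_add, map_add, map_smul] at hR
  simp only [sub_apply, smul_apply, mul_apply_eq_comp]
  linear_combination (norm := module) -hR

theorem isStarNormal_resolventI (hT : IsSelfAdjoint T) : IsStarNormal (resolventI hT) where
  star_comm_self := by
    have h := (star_resolventI_sub hT).symm.trans (star_resolventI_sub' hT)
    exact smul_right_injective _ (by simp : (2 * Complex.I) ≠ 0) h

end Resolvent

section SpectralTheorem

open Filter Topology

theorem im_eq_neg_norm_sq_of_conj_sub {w : ℂ}
    (hw : (starRingEnd ℂ) w - w = 2 * Complex.I * ((starRingEnd ℂ) w * w)) :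
    w.im = -‖w‖ ^ 2 := by
  have h := congrArg Complex.im hw
  rw [Complex.conj_mul'] at h
  simp only [← Complex.ofReal_pow, Complex.sub_im, Complex.conj_im, Complex.mul_im, Complex.mul_re,
    Complex.I_re, Complex.I_im, Complex.re_ofNat, Complex.im_ofNat, Complex.ofReal_re,
    Complex.ofReal_im] at h
  linarith

theorem norm_inv_sq_of_im_eq_neg_norm_sq {w : ℂ} (hw : w.im = -‖w‖ ^ 2) (h0 : w ≠ 0) :
    ‖w⁻¹‖ ^ 2 = (w⁻¹).re ^ 2 + 1 := by
  have hn : ‖w‖ ^ 2 ≠ 0 := by simpa using h0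
  have him : (w⁻¹).im = 1 := by
    rw [Complex.inv_im, hw, Complex.normSq_eq_norm_sq, neg_neg, div_self hn]
  rw [← Complex.normSq_eq_norm_sq, Complex.normSq_apply, him]
  ring

theorem norm_sq_mul_inv_re (w : ℂ) : ‖w‖ ^ 2 * (w⁻¹).re = w.re := by
  by_cases h0 : w = 0
  · simp [h0]
  have hn : ‖w‖ ^ 2 ≠ 0 := by simpa using h0
  rw [Complex.inv_re, Complex.normSq_eq_norm_sq, mul_div_cancel₀ _ hn]

theorem norm_sq_mul_inv_re_sq_le (w : ℂ) : ‖w‖ ^ 2 * (w⁻¹).re ^ 2 ≤ 1 := by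
  have h : ‖w‖ * |(w⁻¹).re| ≤ 1 :=
    (mul_le_mul_of_nonneg_left ((Complex.abs_re_le_norm _).trans (norm_inv w).le)
      (norm_nonneg w)).trans mul_inv_le_one
  rw [← sq_abs (w⁻¹).re, ← mul_pow]
  exact pow_le_one₀ (by positivity) h

theorem measurable_inv_re {X : Type*} [TopologicalSpace X] [MeasurableSpace X]
    [OpensMeasurableSpace X] (z : C(X, ℂ)) : Measurable fun t => ((z t)⁻¹).re :=
  Complex.measurable_re.comp z.continuous.measurable.inv

variable {H : Type v} [NormedAddCommGroup H] [InnerProductSpace ℂ H] [CompleteSpace H]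
  {X : Type*} [MetricSpace X] [CompactSpace X] [MeasurableSpace X] [BorelSpace X]
  (Φ : C(X, ℂ) →⋆ₐ[ℂ] (H →L[ℂ] H)) (z : C(X, ℂ))

theorem ae_ne_zero_of_injective (hz : Function.Injective (Φ z)) (x : H) :
    ∀ᵐ t ∂(cyclicMeasure Φ x), z t ≠ 0 := by
  have hE : MeasurableSet {t | z t = 0} :=
    (isClosed_singleton.preimage z.continuous).measurableSet
  have h : Φ z (spectralVector Φ hE x) = cyclicIsometry Φ x 0 := by
    refine apply_cyclicIsometry Φ x z ?_
    filter_upwards [Lp.coeFn_zero ℂ 2 (cyclicMeasure Φ x),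
      indicatorConstLp_coeFn (p := 2) (hs := hE) (hμs := measure_ne_top (cyclicMeasure Φ x) _)
        (c := (1 : ℂ))] with t h₁ h₂
    rw [h₁, h₂, Pi.zero_apply, Set.indicator_apply]
    split_ifs with ht
    · rw [ht.out, zero_mul]
    · rw [mul_zero]
  have h0 : spectralVector Φ hE x = 0 := hz (by rw [h, map_zero, map_zero])
  have hμ := norm_sq_spectralVector Φ hE x
  rw [h0, norm_zero, zero_pow two_ne_zero] at hμ
  rw [ae_iff]
  simpa only [not_not] using (measureReal_eq_zero_iff).1 hμ.symm

theorem exists_apply_eq_of_memLp_inv (hz : Function.Injective (Φ z)) {x : H}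
    (hx : MemLp (fun t => (z t)⁻¹) 2 (cyclicMeasure Φ x)) : ∃ y, Φ z y = x := by
  refine ⟨cyclicIsometry Φ x (hx.toLp _), ?_⟩
  conv_rhs => rw [← cyclicIsometry_indicator_univ Φ x]
  refine apply_cyclicIsometry Φ x z ?_
  filter_upwards [hx.coeFn_toLp, ae_ne_zero_of_injective Φ z hz x,
    indicatorConstLp_coeFn (p := 2) (hs := MeasurableSet.univ)
      (hμs := measure_ne_top (cyclicMeasure Φ x) _) (c := (1 : ℂ))] with t h₁ h₂ h₃
  rw [h₁, h₃, mul_inv_cancel₀ h₂, Set.indicator_univ]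

theorem integrable_inv_re_sq_apply (y : H) :
    Integrable (fun t => ((z t)⁻¹).re ^ 2) (cyclicMeasure Φ (Φ z y)) := by
  rw [cyclicMeasure_apply, integrable_withDensity_iff_integrable_smul' (by fun_prop) (by simp)]
  refine Integrable.of_bound (C := 1) ?_ (Eventually.of_forall fun t => ?_)
  · have := measurable_inv_re z
    exact Measurable.aestronglyMeasurable (by fun_prop)
  · rw [ENNReal.toReal_ofReal (sq_nonneg _), smul_eq_mul, Real.norm_of_nonneg (by positivity)]
    exact norm_sq_mul_inv_re_sq_le _

variable {z}

theorem mem_range_iff_integrable_inv_re_sq (hinj : Function.Injective (Φ z))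
    (hz : ∀ t, (z t).im = -‖z t‖ ^ 2) (x : H) :
    x ∈ Set.range (Φ z) ↔ Integrable (fun t => ((z t)⁻¹).re ^ 2) (cyclicMeasure Φ x) := by
  constructor
  · rintro ⟨y, rfl⟩
    exact integrable_inv_re_sq_apply Φ z y
  · intro hx
    refine exists_apply_eq_of_memLp_inv Φ z hinj ?_
    have hmeas : Measurable fun t => (z t)⁻¹ := z.continuous.measurable.inv
    rw [memLp_two_iff_integrable_sq_norm hmeas.aestronglyMeasurable]
    refine (hx.add (integrable_const 1)).congr ?_
    filter_upwards [ae_ne_zero_of_injective Φ z hinj x] with t ht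
    exact (norm_inv_sq_of_im_eq_neg_norm_sq (hz t) ht).symm

theorem integral_inv_re_apply (hz : ∀ t, (z t).im = -‖z t‖ ^ 2) (y : H) :
    ((∫ t, ((z t)⁻¹).re ∂(cyclicMeasure Φ (Φ z y)) : ℝ) : ℂ) =
      ⟪Φ z y, y - Complex.I • Φ z y⟫_ℂ := by
  have hre (t : X) : ((‖z t‖ ^ 2 * ((z t)⁻¹).re : ℝ) : ℂ) =
      (star z - Complex.I • (star z * z)) t := by
    have hnorm : (star z * z) t = ((‖z t‖ ^ 2 : ℝ) : ℂ) := by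
      simpa using Complex.conj_mul' (z t)
    rw [norm_sq_mul_inv_re, ContinuousMap.sub_apply, ContinuousMap.smul_apply, hnorm]
    apply Complex.ext <;> simp [-Complex.ofReal_pow, hz t]
  have hinner : ⟪Φ z y, y - Complex.I • Φ z y⟫_ℂ =
      ⟪y, Φ (star z - Complex.I • (star z * z)) y⟫_ℂ := by
    rw [← ContinuousLinearMap.adjoint_inner_right, ← ContinuousLinearMap.star_eq_adjoint,
      ← map_star, map_sub, map_smul, map_sub Φ, map_smul Φ, map_mul Φ]
    rfl
  rw [hinner, inner_apply_eq_integral, cyclicMeasure_apply, ← integral_complex_ofReal,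
    integral_withDensity_eq_integral_toReal_smul (by fun_prop) (by simp)]
  congr with t
  rw [ENNReal.toReal_ofReal (sq_nonneg _), Complex.real_smul, ← Complex.ofReal_mul, hre]

theorem mem_domain_iff_mem_range_resolventI {T : H →ₗ.[ℂ] H} (hT : IsSelfAdjoint T) (x : H) :
    x ∈ T.domain ↔ x ∈ Set.range (resolventI hT) := by
  refine ⟨fun hx => ⟨_, resolventI_apply hT ⟨x, hx⟩⟩, ?_⟩
  rintro ⟨y, rfl⟩
  exact (exists_apply_resolventI hT y).1

theorem exists_isSpectralMeasureOf {T : H →ₗ.[ℂ] H} (hT : IsSelfAdjoint T) :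
    ∃ P : PVM H, P.IsSpectralMeasureOf T := by
  let R := resolventI hT
  have hR : IsStarNormal R := isStarNormal_resolventI hT
  have : CompactSpace (spectrum ℂ R) := isCompact_iff_compactSpace.1 (spectrum.isCompact R)
  let Φ : C(spectrum ℂ R, ℂ) →⋆ₐ[ℂ] (H →L[ℂ] H) := cfcHom hR
  let z : C(spectrum ℂ R, ℂ) := (ContinuousMap.id ℂ).restrict (spectrum ℂ R)
  have hΦz : Φ z = R := cfcHom_id hR
  have hinj : Function.Injective (Φ z) := by
    rw [hΦz]
    exact resolventI_injective hT
  have hz (t : spectrum ℂ R) : (z t).im = -‖z t‖ ^ 2 := by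
    have hΦ : Φ (star z - z) = Φ ((2 * Complex.I) • (star z * z)) := by
      rw [map_sub, map_smul, map_mul, map_star, hΦz, star_resolventI_sub]
    exact im_eq_neg_norm_sq_of_conj_sub
      (DFunLike.congr_fun ((cfcHom_isClosedEmbedding hR).injective hΦ) t)
  refine ⟨spectralPVM Φ (measurable_inv_re z), fun x => ?_, fun x => ?_⟩
  · rw [spectralPVM_measure, integrable_map_measure (by fun_prop)
      (measurable_inv_re z).aemeasurable, mem_domain_iff_mem_range_resolventI hT]
    have h := mem_range_iff_integrable_inv_re_sq Φ hinj hz x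
    rwa [hΦz] at h
  · have h := integral_inv_re_apply Φ hz (T x + Complex.I • (x : H))
    rw [hΦz, resolventI_apply, add_sub_cancel_right] at h
    rw [spectralPVM_measure, integral_map (measurable_inv_re z).aemeasurable (by fun_prop)]
    exact h.symm

end SpectralTheorem

section SignedDensity

variable {X : Type*} [MeasurableSpace X] {μ ν ρ : Measure X} {g h : X → ℝ}

theorem add_withDensity_neg_eq_add_withDensity [IsFiniteMeasure μ] [IsFiniteMeasure ν]
    (hg : Integrable g ρ)
    (hμν : ∀ F, MeasurableSet F → μ.real F - ν.real F = ∫ t in F, g t ∂ρ) :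
    μ + ρ.withDensity (fun t => ENNReal.ofReal (-g t)) =
      ν + ρ.withDensity fun t => ENNReal.ofReal (g t) := by
  have := isFiniteMeasure_withDensity_ofReal hg.2
  have := isFiniteMeasure_withDensity_ofReal hg.neg.2
  simp only [Pi.neg_apply] at this
  ext F hF
  rw [← measureReal_eq_measureReal_iff, measureReal_add_apply, measureReal_add_apply]
  have hF' := hμν F hF
  rw [integral_eq_lintegral_pos_part_sub_lintegral_neg_part hg.restrict,
    ← withDensity_apply _ hF, ← withDensity_apply _ hF] at hF'
  simp only [measureReal_def] at hF' ⊢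
  linarith

theorem integrable_withDensity_ofReal (hg : Measurable g)
    (hgh : Integrable (fun t => g t * h t) ρ) :
    Integrable h (ρ.withDensity fun t => ENNReal.ofReal (g t)) := by
  rw [integrable_withDensity_iff_integrable_smul' (by fun_prop) (by simp)]
  have hpos : MeasurableSet {t | 0 ≤ g t} := measurableSet_le measurable_const hg
  refine (hgh.indicator hpos).congr (ae_of_all _ fun t => ?_)
  by_cases ht : 0 ≤ g t
  · simp [ht]
  · simp [ht, ENNReal.ofReal_of_nonpos (not_le.1 ht).le]

theorem integral_sub_integral_eq_integral_mul [IsFiniteMeasure μ] [IsFiniteMeasure ν]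
    (hg : Measurable g) (hgi : Integrable g ρ)
    (hμν : ∀ F, MeasurableSet F → μ.real F - ν.real F = ∫ t in F, g t ∂ρ)
    (hhμ : Integrable h μ) (hhν : Integrable h ν) (hgh : Integrable (fun t => g t * h t) ρ) :
    ∫ t, h t ∂μ - ∫ t, h t ∂ν = ∫ t, g t * h t ∂ρ := by
  have hpos := integrable_withDensity_ofReal hg hgh
  have hneg : Integrable h (ρ.withDensity fun t => ENNReal.ofReal (-g t)) :=
    integrable_withDensity_ofReal hg.neg (hgh.neg.congr (ae_of_all _ fun t => (neg_mul _ _).symm))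
  have hadd := congrArg (fun κ : Measure X => ∫ t, h t ∂κ)
    (add_withDensity_neg_eq_add_withDensity hgi hμν)
  simp only [integral_add_measure hhμ hneg, integral_add_measure hhν hpos] at hadd
  rw [integral_withDensity_eq_integral_toReal_smul (by fun_prop) (by simp),
    integral_withDensity_eq_integral_toReal_smul (by fun_prop) (by simp)] at hadd
  rw [integrable_withDensity_iff_integrable_smul' (by fun_prop) (by simp)] at hpos hneg
  rw [sub_eq_sub_iff_add_eq_add.2 (hadd.trans (add_comm _ _)), ← integral_sub hpos hneg]
  refine integral_congr_ae (Filter.Eventually.of_forall fun t => ?_)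
  simp only [ENNReal.toReal_ofReal', smul_eq_mul, ← sub_mul, max_zero_sub_eq_self]

end SignedDensity

section PVMCalculus

theorem IsSymmetricOperator.inner_orbit {H : Type v} [NormedAddCommGroup H]
    [InnerProductSpace ℂ H] {T : H →ₗ.[ℂ] H} (hT : IsSymmetricOperator T) {x : ℕ → T.domain}
    (hx : ∀ n, (x (n + 1) : H) = T (x n)) (j k : ℕ) :
    ⟪(x j : H), (x k : H)⟫_ℂ = ⟪(x 0 : H), (x (j + k) : H)⟫_ℂ := by
  induction j generalizing k with
  | zero => rw [zero_add]
  | succ j ih => rw [hx j, hT.hermitian, ← hx k, ih, add_right_comm, add_assoc]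

variable {H : Type v} [NormedAddCommGroup H] [InnerProductSpace ℂ H] [CompleteSpace H]

namespace PVM

variable (P : PVM H)

instance (x : H) : IsFiniteMeasure (P.measure x) :=
  ⟨by rw [P.measure_apply x MeasurableSet.univ]; exact ENNReal.ofReal_lt_top⟩

theorem inner_proj_left {E : Set ℝ} (hE : MeasurableSet E) (x y : H) :
    ⟪P.proj E x, y⟫_ℂ = ⟪x, P.proj E y⟫_ℂ :=
  (P.isProj E hE).isSelfAdjoint.isSymmetric x y

theorem measureReal_eq_norm_sq {E : Set ℝ} (hE : MeasurableSet E) (x : H) :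
    (P.measure x).real E = ‖P.proj E x‖ ^ 2 := by
  rw [measureReal_def, P.measure_apply x hE, P.inner_eq hE, Complex.ofReal_re,
    ENNReal.toReal_ofReal (sq_nonneg _)]

theorem measureReal_univ (x : H) : (P.measure x).real Set.univ = ‖x‖ ^ 2 := by
  rw [P.measureReal_eq_norm_sq MeasurableSet.univ, P.univ, one_apply_eq_self]

theorem proj_union {E F : Set ℝ} (hE : MeasurableSet E) (hF : MeasurableSet F)
    (hd : Disjoint E F) : P.proj (E ∪ F) = P.proj E + P.proj F := by
  refine ContinuousLinearMap.coe_injective ((ext_inner_map _ _).1 fun x => ?_)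
  have h := measureReal_union (μ := P.measure x) hd hF
  simp only [P.measureReal_eq_norm_sq, hE, hF, hE.union hF] at h
  simp only [ContinuousLinearMap.coe_coe, add_apply, inner_add_left,
    P.inner_proj_left, P.inner_eq, hE, hF, hE.union hF, h, Complex.ofReal_add]

theorem proj_mul_of_subset {E F : Set ℝ} (hE : MeasurableSet E) (hF : MeasurableSet F)
    (h : E ⊆ F) : P.proj E * P.proj F = P.proj E := by
  have : IsAddTorsionFree (H →L[ℂ] H) := .of_isTorsionFree ℂ _
  refine ((P.isProj E hE).sub_iff_mul_eq_left (P.isProj F hF)).1 ?_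
  rw [← Set.union_sdiff_cancel h, P.proj_union hE (hF.diff hE) Set.disjoint_sdiff_right,
    add_sub_cancel_left]
  exact P.isProj _ (hF.diff hE)

theorem proj_mul_of_disjoint {E F : Set ℝ} (hE : MeasurableSet E) (hF : MeasurableSet F)
    (h : Disjoint E F) : P.proj E * P.proj F = 0 := by
  have := P.proj_mul_of_subset hE (hE.union hF) Set.subset_union_left
  rwa [P.proj_union hE hF h, mul_add, (P.isProj E hE).isIdempotentElem.eq, add_eq_left] at this

theorem proj_mul {E F : Set ℝ} (hE : MeasurableSet E) (hF : MeasurableSet F) :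
    P.proj E * P.proj F = P.proj (E ∩ F) := by
  conv_lhs => rw [← Set.inter_union_sdiff E F]
  rw [P.proj_union (hE.inter hF) (hE.diff hF) Set.disjoint_sdiff_inter.symm, add_mul,
    P.proj_mul_of_subset (hE.inter hF) hF Set.inter_subset_right,
    P.proj_mul_of_disjoint (hE.diff hF) hF Set.disjoint_sdiff_left, add_zero]

theorem measure_proj {E : Set ℝ} (hE : MeasurableSet E) (x : H) :
    P.measure (P.proj E x) = (P.measure x).restrict E := by
  ext F hF
  rw [← measureReal_eq_measureReal_iff, measureReal_restrict_apply hF,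
    P.measureReal_eq_norm_sq hF, P.measureReal_eq_norm_sq (hF.inter hE), ← P.proj_mul hF hE,
    mul_apply_eq_comp]

theorem four_mul_re_inner_proj {E : Set ℝ} (hE : MeasurableSet E) (x y : H) :
    4 * (⟪x, P.proj E y⟫_ℂ).re =
      (P.measure (x + y)).real E - (P.measure (x - y)).real E := by
  have h : ⟪x, P.proj E y⟫_ℂ = ⟪P.proj E x, P.proj E y⟫_ℂ := by
    rw [P.inner_proj_left hE, ← mul_apply_eq_comp, (P.isProj E hE).isIdempotentElem.eq]
  have := re_inner_eq_norm_add_mul_self_sub_norm_sub_mul_self_div_four (𝕜 := ℂ)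
    (P.proj E x) (P.proj E y)
  rw [P.measureReal_eq_norm_sq hE, P.measureReal_eq_norm_sq hE, map_add, map_sub, h]
  rw [RCLike.re_eq_complex_re] at this
  linarith

namespace IsSpectralMeasureOf

variable {P : PVM H} {T : H →ₗ.[ℂ] H}

theorem integrable_id (hP : P.IsSpectralMeasureOf T) {x : H} (hx : x ∈ T.domain) :
    Integrable (fun t : ℝ => t) (P.measure x) :=
  ((memLp_two_iff_integrable_sq aestronglyMeasurable_id).2
    ((hP.mem_domain x).1 hx)).integrable one_le_two

theorem four_mul_re_inner_apply (hP : P.IsSpectralMeasureOf T) (hT : IsSymmetricOperator T)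
    (x y : T.domain) :
    4 * (⟪(x : H), T y⟫_ℂ).re =
      ∫ t, t ∂P.measure ((x : H) + y) - ∫ t, t ∂P.measure ((x : H) - y) := by
  have hadd := congrArg Complex.re (hP.inner_apply (x + y))
  have hsub := congrArg Complex.re (hP.inner_apply (x - y))
  have hyx : (⟪(y : H), T x⟫_ℂ).re = (⟪(x : H), T y⟫_ℂ).re := by
    rw [← hT.hermitian, ← inner_conj_symm, Complex.conj_re]
  simp only [LinearPMap.map_add, LinearPMap.map_sub, Submodule.coe_add, Submodule.coe_sub,
    inner_add_left, inner_add_right, inner_sub_left, inner_sub_right, Complex.add_re,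
    Complex.sub_re, Complex.ofReal_re, hyx] at hadd hsub
  linarith

theorem re_inner_apply_congr (hP : P.IsSpectralMeasureOf T) (hT : IsSymmetricOperator T)
    {x y x' y' : T.domain}
    (h : ∀ E, MeasurableSet E → ⟪(x : H), P.proj E y⟫_ℂ = ⟪(x' : H), P.proj E y'⟫_ℂ) :
    (⟪(x : H), T y⟫_ℂ).re = (⟪(x' : H), T y'⟫_ℂ).re := by
  have hmeas : P.measure ((x : H) + y) + P.measure ((x' : H) - y') =
      P.measure ((x' : H) + y') + P.measure ((x : H) - y) := by
    ext E hE
    have hE' := P.four_mul_re_inner_proj hE x y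
    rw [h E hE, P.four_mul_re_inner_proj hE] at hE'
    rw [← measureReal_eq_measureReal_iff, measureReal_add_apply, measureReal_add_apply]
    linarith
  have hint := congrArg (fun μ : Measure ℝ => ∫ t, t ∂μ) hmeas
  rw [integral_add_measure (hP.integrable_id (add_mem x.2 y.2))
      (hP.integrable_id (sub_mem x'.2 y'.2)),
    integral_add_measure (hP.integrable_id (add_mem x'.2 y'.2))
      (hP.integrable_id (sub_mem x.2 y.2))] at hint
  linarith [hP.four_mul_re_inner_apply hT x y, hP.four_mul_re_inner_apply hT x' y']

theorem proj_mem_domain (hP : P.IsSpectralMeasureOf T) {E : Set ℝ} (hE : MeasurableSet E)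
    (x : T.domain) : P.proj E x ∈ T.domain := by
  rw [hP.mem_domain, P.measure_proj hE]
  exact ((hP.mem_domain x).1 x.2).restrict

theorem proj_mem_domain_of_isBounded (hP : P.IsSpectralMeasureOf T) {E : Set ℝ}
    (hE : MeasurableSet E) (hb : Bornology.IsBounded E) (x : H) : P.proj E x ∈ T.domain := by
  obtain ⟨C, hC⟩ := hb.exists_norm_le
  rw [hP.mem_domain, P.measure_proj hE]
  refine Measure.integrableOn_of_bounded (M := C ^ 2) (measure_ne_top _ _) (by fun_prop)
    (ae_restrict_of_forall_mem hE fun t ht => ?_)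
  rw [norm_pow]
  exact pow_le_pow_left₀ (norm_nonneg t) (hC t ht) 2

theorem apply_proj (hP : P.IsSpectralMeasureOf T) (hT : IsSymmetricOperator T)
    {E : Set ℝ} (hE : MeasurableSet E) (x : T.domain) :
    T ⟨P.proj E x, hP.proj_mem_domain hE x⟩ = P.proj E (T x) := by
  set v := T ⟨P.proj E x, hP.proj_mem_domain hE x⟩ - P.proj E (T x) with hv
  have hre : (fun y : H => (⟪y, v⟫_ℂ).re) = fun _ => 0 := by
    refine Continuous.ext_on hT.dense_domain (by fun_prop) continuous_const fun y hy => ?_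
    have h := hP.re_inner_apply_congr hT (x := ⟨y, hy⟩) (y := ⟨_, hP.proj_mem_domain hE x⟩)
      (x' := ⟨_, hP.proj_mem_domain hE ⟨y, hy⟩⟩) (y' := x) fun F hF => by
        simp only [P.inner_proj_left hE, ← mul_apply_eq_comp, P.proj_mul, hE, hF, Set.inter_comm]
    simp only [P.inner_proj_left hE] at h
    simp only [hv, inner_sub_right, Complex.sub_re, h, sub_self]
  have hvv : (⟪v, v⟫_ℂ).re = 0 := congrFun hre v
  rw [← sub_eq_zero, ← hv, ← norm_eq_zero, ← sq_eq_zero_iff, ← inner_self_eq_norm_sq (𝕜 := ℂ)]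
  exact hvv

theorem inner_proj_apply (hP : P.IsSpectralMeasureOf T) (hT : IsSymmetricOperator T)
    {E : Set ℝ} (hE : MeasurableSet E) (x : T.domain) :
    ⟪(x : H), P.proj E (T x)⟫_ℂ = ((∫ t in E, t ∂P.measure (x : H) : ℝ) : ℂ) := by
  rw [← P.measure_proj hE, ← hP.inner_apply ⟨_, hP.proj_mem_domain hE x⟩,
    hP.apply_proj hT hE, P.inner_proj_left hE, ← mul_apply_eq_comp,
    (P.isProj E hE).isIdempotentElem.eq]

theorem norm_apply_sq_of_mem_domain (hP : P.IsSpectralMeasureOf T) (hT : IsSymmetricOperator T)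
    {x : T.domain} (hx : T x ∈ T.domain) :
    ‖T x‖ ^ 2 = ∫ t, t ^ 2 ∂P.measure (x : H) := by
  obtain ⟨y, hy⟩ : ∃ y : T.domain, (y : H) = T x := ⟨⟨_, hx⟩, rfl⟩
  have hsub : ∀ E, MeasurableSet E → (P.measure ((x : H) + y)).real E -
      (P.measure ((x : H) - y)).real E = ∫ t in E, 4 * t ∂P.measure (x : H) := fun E hE => by
    rw [← P.four_mul_re_inner_proj hE, hy, hP.inner_proj_apply hT hE, Complex.ofReal_re,
      integral_const_mul]
  have hsq : Integrable (fun t : ℝ => 4 * t * t) (P.measure (x : H)) := by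
    simpa only [sq, mul_assoc] using ((hP.mem_domain x).1 x.2).const_mul 4
  have h := integral_sub_integral_eq_integral_mul (by fun_prop)
    ((hP.integrable_id x.2).const_mul 4) hsub (hP.integrable_id (add_mem x.2 y.2))
    (hP.integrable_id (sub_mem x.2 y.2)) hsq
  rw [← hP.four_mul_re_inner_apply hT x y, ← hT.hermitian, hy] at h
  simp only [mul_assoc, ← sq, integral_const_mul] at h
  rw [← inner_self_eq_norm_sq (𝕜 := ℂ)]
  exact mul_left_cancel₀ four_ne_zero h

theorem measure_apply_of_mem_domain (hP : P.IsSpectralMeasureOf T) (hT : IsSymmetricOperator T)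
    {x : T.domain} (hx : T x ∈ T.domain) :
    P.measure (T x) = (P.measure (x : H)).withDensity fun t => ENNReal.ofReal (t ^ 2) := by
  ext E hE
  have hEx : T ⟨_, hP.proj_mem_domain hE x⟩ ∈ T.domain := by
    rw [hP.apply_proj hT hE]
    exact hP.proj_mem_domain hE ⟨_, hx⟩
  rw [withDensity_apply _ hE, ← P.measure_proj hE, ← ofReal_integral_eq_lintegral_ofReal
    ((hP.mem_domain _).1 (hP.proj_mem_domain hE x)) (ae_of_all _ sq_nonneg),
    ← hP.norm_apply_sq_of_mem_domain hT hEx, hP.apply_proj hT hE, ← P.measureReal_eq_norm_sq hE,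
    ofReal_measureReal]

theorem measure_apply (hP : P.IsSpectralMeasureOf T) (hT : IsSymmetricOperator T) (x : T.domain) :
    P.measure (T x) = (P.measure (x : H)).withDensity fun t => ENNReal.ofReal (t ^ 2) := by
  refine (Measure.ext_iff_of_iUnion_eq_univ (Metric.iUnion_closedBall_nat (0 : ℝ))).2 fun n => ?_
  have hE : MeasurableSet (Metric.closedBall (0 : ℝ) n) := measurableSet_closedBall
  have hx := hP.proj_mem_domain_of_isBounded hE Metric.isBounded_closedBall (T x)
  rw [← hP.apply_proj hT hE] at hx
  rw [← P.measure_proj hE, ← hP.apply_proj hT hE, hP.measure_apply_of_mem_domain hT hx,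
    restrict_withDensity hE, P.measure_proj hE]

section Orbit

variable {x : ℕ → T.domain}

theorem measure_orbit (hP : P.IsSpectralMeasureOf T) (hT : IsSymmetricOperator T)
    (hx : ∀ n, (x (n + 1) : H) = T (x n)) (n : ℕ) :
    P.measure (x n : H) =
      (P.measure (x 0 : H)).withDensity fun t => ENNReal.ofReal (t ^ (2 * n)) := by
  induction n with
  | zero => simp only [mul_zero, pow_zero, ENNReal.ofReal_one, withDensity_const, one_smul]
  | succ n ih =>
    rw [hx, hP.measure_apply hT, ih, ← withDensity_mul _ (by fun_prop) (by fun_prop)]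
    congr with t
    rw [Pi.mul_apply, ← ENNReal.ofReal_mul ((even_two_mul n).pow_nonneg t), mul_add_one, pow_add]

theorem integrable_orbit_iff (hP : P.IsSpectralMeasureOf T) (hT : IsSymmetricOperator T)
    (hx : ∀ n, (x (n + 1) : H) = T (x n)) (n : ℕ) {f : ℝ → ℝ} :
    Integrable f (P.measure (x n : H)) ↔
      Integrable (fun t => t ^ (2 * n) * f t) (P.measure (x 0 : H)) := by
  rw [hP.measure_orbit hT hx n,
    integrable_withDensity_iff_integrable_smul' (by fun_prop) (by simp)]
  simp only [ENNReal.toReal_ofReal ((even_two_mul n).pow_nonneg _), smul_eq_mul]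

theorem integral_orbit (hP : P.IsSpectralMeasureOf T) (hT : IsSymmetricOperator T)
    (hx : ∀ n, (x (n + 1) : H) = T (x n)) (n : ℕ) (f : ℝ → ℝ) :
    ∫ t, f t ∂P.measure (x n : H) = ∫ t, t ^ (2 * n) * f t ∂P.measure (x 0 : H) := by
  rw [hP.measure_orbit hT hx n,
    integral_withDensity_eq_integral_toReal_smul (by fun_prop) (by simp)]
  simp only [ENNReal.toReal_ofReal ((even_two_mul n).pow_nonneg _), smul_eq_mul]

theorem integrable_pow (hP : P.IsSpectralMeasureOf T) (hT : IsSymmetricOperator T)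
    (hx : ∀ n, (x (n + 1) : H) = T (x n)) (n : ℕ) :
    Integrable (fun t : ℝ => t ^ n) (P.measure (x 0 : H)) := by
  obtain ⟨k, rfl | rfl⟩ := n.even_or_odd'
  · simpa only [mul_one] using
      (hP.integrable_orbit_iff hT hx k).1 (integrable_const (1 : ℝ))
  · simpa only [pow_succ] using
      (hP.integrable_orbit_iff hT hx k).1 (hP.integrable_id (x k).2)

theorem inner_orbit_eq_integral_pow (hP : P.IsSpectralMeasureOf T) (hT : IsSymmetricOperator T)
    (hx : ∀ n, (x (n + 1) : H) = T (x n)) (n : ℕ) :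
    ⟪(x 0 : H), (x n : H)⟫_ℂ = ((∫ t, t ^ n ∂P.measure (x 0 : H) : ℝ) : ℂ) := by
  obtain ⟨k, rfl | rfl⟩ := n.even_or_odd'
  · have h := hP.integral_orbit hT hx k fun _ => 1
    simp only [integral_const, P.measureReal_univ, smul_eq_mul, mul_one] at h
    rw [two_mul, ← hT.inner_orbit hx, inner_self_eq_norm_sq_to_K, ← two_mul, ← h]
    push_cast
    rfl
  · have h := hP.integral_orbit hT hx k fun t => t
    simp only [← pow_succ] at h
    rw [two_mul, add_assoc, ← hT.inner_orbit hx, hx, hP.inner_apply, h, ← add_assoc, ← two_mul]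

end Orbit

end IsSpectralMeasureOf

end PVM

end PVMCalculus

section MomentDeterminacy

open Filter Topology ProbabilityTheory

theorem complexMGF_eventuallyEq_of_integral_pow_eq {μ ν : Measure ℝ}
    (hμ : 0 ∈ interior (integrableExpSet id μ)) (hν : 0 ∈ interior (integrableExpSet id ν))
    (h : ∀ n : ℕ, ∫ t, t ^ n ∂μ = ∫ t, t ^ n ∂ν) :
    complexMGF id μ =ᶠ[𝓝 0] complexMGF id ν := by
  have hderiv : ∀ {ρ : Measure ℝ}, 0 ∈ interior (integrableExpSet id ρ) → ∀ n : ℕ,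
      iteratedDeriv n (complexMGF id ρ) 0 = ((∫ t, t ^ n ∂ρ : ℝ) : ℂ) := fun hρ n => by
    rw [iteratedDeriv_complexMGF (by simpa using hρ), ← integral_complex_ofReal]
    simp
  have hpμ := (analyticAt_complexMGF (z := 0) (by simpa using hμ)).hasFPowerSeriesAt
  have hpν := (analyticAt_complexMGF (z := 0) (by simpa using hν)).hasFPowerSeriesAt
  simp only [hderiv hμ, hderiv hν, h] at hpμ hpν
  filter_upwards [hpμ.eventually_hasSum_sub, hpν.eventually_hasSum_sub] with z hzμ hzν
  exact hzμ.unique hzν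

theorem eq_of_integral_pow_eq {μ ν : Measure ℝ} [IsFiniteMeasure μ] [IsFiniteMeasure ν]
    (hμ : 0 ∈ interior (integrableExpSet id μ)) (hν : 0 ∈ interior (integrableExpSet id ν))
    (h : ∀ n : ℕ, ∫ t, t ^ n ∂μ = ∫ t, t ^ n ∂ν) : μ = ν := by
  let S : Set ℂ := {z | z.re ∈ interior (integrableExpSet id μ) ∩ interior (integrableExpSet id ν)}
  have hS : IsPreconnected S := ((convex_integrableExpSet.interior.inter
    convex_integrableExpSet.interior).linear_preimage Complex.reLm).isPreconnected
  have hEq : Set.EqOn (complexMGF id μ) (complexMGF id ν) S :=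
    AnalyticOnNhd.eqOn_of_preconnected_of_eventuallyEq (fun z hz => analyticAt_complexMGF hz.1)
      (fun z hz => analyticAt_complexMGF hz.2) hS (z₀ := 0) (by simpa [S] using ⟨hμ, hν⟩)
      (complexMGF_eventuallyEq_of_integral_pow_eq hμ hν h)
  refine Measure.ext_of_charFun (funext fun t => ?_)
  rw [← complexMGF_id_mul_I, ← complexMGF_id_mul_I]
  exact hEq (by simpa [S] using ⟨hμ, hν⟩)

theorem ae_abs_lt_of_integral_pow_le {μ : Measure ℝ} [IsFiniteMeasure μ]
    (hint : ∀ n : ℕ, Integrable (fun t : ℝ => t ^ (2 * n)) μ) {K r R : ℝ} (hr : 0 ≤ r)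
    (hrR : r < R) (hb : ∀ n : ℕ, ∫ t, t ^ (2 * n) ∂μ ≤ K * r ^ (2 * n)) :
    ∀ᵐ t ∂μ, |t| < R := by
  have hR : 0 < R := hr.trans_lt hrR
  have hmarkov : ∀ n : ℕ, μ.real {t | R ≤ |t|} ≤ K * ((r / R) ^ 2) ^ n := fun n => by
    have hsub : {t : ℝ | R ≤ |t|} ⊆ {t | R ^ (2 * n) ≤ t ^ (2 * n)} := fun t ht => by
      rw [Set.mem_ofPred_eq, ← (even_two_mul n).pow_abs t]
      exact pow_le_pow_left₀ hR.le ht _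
    rw [← pow_mul, div_pow, ← mul_div_assoc, le_div_iff₀' (by positivity)]
    calc R ^ (2 * n) * μ.real {t | R ≤ |t|}
        ≤ R ^ (2 * n) * μ.real {t | R ^ (2 * n) ≤ t ^ (2 * n)} :=
          mul_le_mul_of_nonneg_left (measureReal_mono hsub) (by positivity)
      _ ≤ ∫ t, t ^ (2 * n) ∂μ := mul_meas_ge_le_integral_of_nonneg
          (ae_of_all _ fun t => (even_two_mul n).pow_nonneg t) (hint n) _
      _ ≤ K * r ^ (2 * n) := hb n
  have hratio : (r / R) ^ 2 < 1 :=
    pow_lt_one₀ (div_nonneg hr hR.le) ((div_lt_one hR).2 hrR) two_ne_zero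
  have hlim := (tendsto_pow_atTop_nhds_zero_of_lt_one (sq_nonneg (r / R)) hratio).const_mul K
  rw [mul_zero] at hlim
  simp only [ae_iff, not_lt]
  exact (measureReal_eq_zero_iff (measure_ne_top _ _)).1
    ((ge_of_tendsto' hlim hmarkov).antisymm measureReal_nonneg)

theorem integrableExpSet_eq_univ_of_integral_pow_le {μ : Measure ℝ} [IsFiniteMeasure μ]
    (hint : ∀ n : ℕ, Integrable (fun t : ℝ => t ^ (2 * n)) μ) {K r : ℝ} (hr : 0 ≤ r)
    (hb : ∀ n : ℕ, ∫ t, t ^ (2 * n) ∂μ ≤ K * r ^ (2 * n)) :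
    integrableExpSet id μ = Set.univ := by
  refine Set.eq_univ_of_forall fun s => integrable_exp_mul_of_mem_Icc aemeasurable_id
    (a := -(r + 1)) (b := r + 1) ?_
  filter_upwards [ae_abs_lt_of_integral_pow_le hint hr (lt_add_one r) hb] with t ht
  exact abs_le.1 ht.le

end MomentDeterminacy

section BoundedSymmetric

open Filter Topology

variable {H : Type v} [NormedAddCommGroup H] [InnerProductSpace ℂ H] [CompleteSpace H]
  {T : H →ₗ.[ℂ] H}

theorem isSelfAdjoint_of_isFormalAdjoint_of_domain_eq_top (hT : T.IsFormalAdjoint T)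
    (htop : T.domain = ⊤) : IsSelfAdjoint T := by
  have hle : T ≤ T.adjoint := hT.le_adjoint (by simp [htop])
  refine LinearPMap.isSelfAdjoint_def.2 (LinearPMap.eq_of_le_of_domain_eq hle ?_).symm
  exact hle.1.antisymm (htop ▸ le_top)

namespace IsSymmetricOperator

theorem isClosable (hT : IsSymmetricOperator T) : T.IsClosable :=
  (LinearPMap.adjoint_isClosed hT.dense_domain).isClosable.leIsClosable
    (LinearPMap.IsFormalAdjoint.le_adjoint hT.dense_domain hT.hermitian)

theorem exists_tendsto_closure (hT : IsSymmetricOperator T) (x : T.closure.domain) :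
    ∃ u : ℕ → T.domain, Tendsto (fun n => (u n : H)) atTop (𝓝 x) ∧
      Tendsto (fun n => T (u n)) atTop (𝓝 (T.closure x)) := by
  have hx := T.closure.mem_graph x
  rw [← hT.isClosable.graph_closure_eq_closure_graph] at hx
  obtain ⟨p, hp, hlim⟩ := mem_closure_iff_seq_limit.1 hx
  choose u hu₁ hu₂ using fun n => (LinearPMap.mem_graph_iff _).1 (hp n)
  rw [Prod.tendsto_iff] at hlim
  exact ⟨u, by simpa only [hu₁] using hlim.1, by simpa only [hu₂] using hlim.2⟩

theorem closure_isFormalAdjoint (hT : IsSymmetricOperator T) :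
    T.closure.IsFormalAdjoint T.closure := fun x y => by
  obtain ⟨u, hu, hTu⟩ := hT.exists_tendsto_closure x
  obtain ⟨w, hw, hTw⟩ := hT.exists_tendsto_closure y
  exact tendsto_nhds_unique (hTu.inner (𝕜 := ℂ) hw)
    ((hu.inner hTw).congr fun n => (hT.hermitian (u n) (w n)).symm)

theorem closure_domain_eq_top_of_bound (hT : IsSymmetricOperator T) {C : ℝ}
    (hC : ∀ x : T.domain, ‖T x‖ ≤ C * ‖(x : H)‖) : T.closure.domain = ⊤ := by
  refine Submodule.eq_top_iff'.2 fun x => ?_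
  obtain ⟨u, hu, hlim⟩ := mem_closure_iff_seq_limit.1 (hT.dense_domain x)
  lift u to ℕ → T.domain using hu
  have hu : CauchySeq u :=
    isUniformEmbedding_subtype_val.isUniformInducing.cauchy_map_iff.1 hlim.cauchySeq
  have hTu : CauchySeq fun n => T (u n) :=
    (AddMonoidHomClass.uniformContinuous_of_bound T.toFun C hC).comp_cauchySeq hu
  obtain ⟨y, hy⟩ := cauchySeq_tendsto_of_complete hTu
  have hxy : (x, y) ∈ T.closure.graph := by
    rw [← hT.isClosable.graph_closure_eq_closure_graph]
    exact mem_closure_of_tendsto (hlim.prodMk_nhds hy)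
      (Eventually.of_forall fun n => T.mem_graph (u n))
  exact LinearPMap.mem_domain_of_mem_graph hxy

theorem isEssentiallySelfAdjoint_of_bound (hT : IsSymmetricOperator T) {C : ℝ}
    (hC : ∀ x : T.domain, ‖T x‖ ≤ C * ‖(x : H)‖) : IsEssentiallySelfAdjoint T :=
  ⟨hT, isSelfAdjoint_of_isFormalAdjoint_of_domain_eq_top hT.closure_isFormalAdjoint
    (hT.closure_domain_eq_top_of_bound hC)⟩

end IsSymmetricOperator

end BoundedSymmetric

namespace GNSQuadruple

section StarAlgebra

variable {A : Type u} [Ring A] [StarRing A] [Algebra ℂ A] {ω : NonNormalizedState A}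
  {H : Type v} [NormedAddCommGroup H] [InnerProductSpace ℂ H] [CompleteSpace H]
  (Q : GNSQuadruple ω H)

theorem inner_π_left (b : A) (x y : Q.D) :
    ⟪(Q.π b x : H), (y : H)⟫_ℂ = ⟪(x : H), (Q.π (star b) y : H)⟫_ℂ := by
  have hle := Q.star_le_adjoint b
  have hstar : (operatorOn Q.D (Q.π b)).adjoint ⟨y, hle.1 y.2⟩ = Q.π (star b) y :=
    (hle.2 (x := y) rfl).symm
  have hadj := (operatorOn Q.D (Q.π b)).adjoint_isFormalAdjoint Q.dense_D ⟨y, hle.1 y.2⟩ x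
  rw [hstar] at hadj
  rw [← inner_conj_symm, ← inner_conj_symm (x : H)]
  exact congrArg _ hadj.symm

theorem isSymmetricOperator_op {a : A} (ha : IsSelfAdjoint a) : IsSymmetricOperator (Q.op a) :=
  ⟨Q.dense_D, fun x y => (Q.inner_π_left a x y).trans (by rw [ha.star_eq]; rfl)⟩

theorem norm_π_ψ_sq (b : A) : ((‖(Q.π b Q.ψ : H)‖ ^ 2 : ℝ) : ℂ) = ω (star b * b) := by
  rw [Q.expectation, map_mul, Module.End.mul_apply, ← Q.inner_π_left, inner_self_eq_norm_sq_to_K,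
    Complex.ofReal_pow]
  rfl

/-- The vectors `π (aⁿ) ψ`, which form the orbit of `ψ` under the closure of `π (a)`. -/
noncomputable def orbit (a : A) (n : ℕ) : (Q.op a).closure.domain :=
  ⟨Q.π (a ^ n) Q.ψ, (Q.op a).le_closure.1 (Q.π (a ^ n) Q.ψ).2⟩

theorem orbit_zero (a : A) : (Q.orbit a 0 : H) = Q.ψ := by
  simp [orbit]

theorem orbit_succ (a : A) (n : ℕ) :
    (Q.orbit a (n + 1) : H) = (Q.op a).closure (Q.orbit a n) := by
  have hclosure : Q.op a (Q.π (a ^ n) Q.ψ) = (Q.op a).closure (Q.orbit a n) :=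
    (Q.op a).le_closure.2 rfl
  rw [← hclosure]
  change (Q.π (a ^ (n + 1)) Q.ψ : H) = Q.π a (Q.π (a ^ n) Q.ψ)
  rw [pow_succ', map_mul, Module.End.mul_apply]

theorem solvesMomentProblem {a : A} (hQ : IsEssentiallySelfAdjoint (Q.op a)) {P : PVM H}
    (hP : P.IsSpectralMeasureOf (Q.op a).closure) :
    SolvesMomentProblem ω a (P.measure Q.ψ) := by
  have hT := isSymmetricOperator_of_isSelfAdjoint hQ.closure_selfAdjoint
  rw [← Q.orbit_zero a]
  refine ⟨hP.integrable_pow hT (Q.orbit_succ a), fun n => ?_⟩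
  rw [← hP.inner_orbit_eq_integral_pow hT (Q.orbit_succ a), Q.orbit_zero, Q.expectation]
  rfl

end StarAlgebra

end GNSQuadruple

theorem SolvesMomentProblem.isFiniteMeasure {A : Type u} [Ring A] [StarRing A] [Algebra ℂ A]
    {ω : NonNormalizedState A} {a : A} {μ : Measure ℝ} (h : SolvesMomentProblem ω a μ) :
    IsFiniteMeasure μ := by
  simpa [integrable_const_iff] using h.integrable 0

theorem NonNormalizedState.nontrivial {A : Type u} [Ring A] [StarRing A] [Algebra ℂ A]
    (ω : NonNormalizedState A) : Nontrivial A :=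
  ⟨1, 0, fun h => ω.map_one_ne_zero' (h ▸ ω.map_zero)⟩

section CStar

variable {A : Type u} [CStarAlgebra A]

theorem NonNormalizedState.apply_star_mul_self_mul_le (ω : NonNormalizedState A) (a b : A) :
    ω (star (a * b) * (a * b)) ≤ ((‖a‖ ^ 2 : ℝ) : ℂ) * ω (star b * b) := by
  let _ := CStarAlgebra.spectralOrder A
  let _ := CStarAlgebra.spectralOrderedRing A
  have hle : star (a * b) * (a * b) ≤ ((‖a‖ ^ 2 : ℝ) : ℂ) • (star b * b) := by
    have h := CStarAlgebra.star_left_conjugate_le_norm_smul (a := b)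
      (IsSelfAdjoint.star_mul_self a)
    rw [CStarRing.norm_star_mul_self, ← sq] at h
    simpa only [star_mul, mul_assoc, Complex.coe_smul] using h
  obtain ⟨c, hc⟩ := CStarAlgebra.nonneg_iff_eq_star_mul_self.1 (sub_nonneg.2 hle)
  rw [← sub_nonneg, ← smul_eq_mul, ← map_smul, ← map_sub, hc]
  exact ω.nonneg' c

namespace GNSQuadruple

variable {ω : NonNormalizedState A} {H : Type v} [NormedAddCommGroup H] [InnerProductSpace ℂ H]
  [CompleteSpace H] (Q : GNSQuadruple ω H)

theorem norm_π_le (a : A) (x : Q.D) : ‖(Q.π a x : H)‖ ≤ ‖a‖ * ‖(x : H)‖ := by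
  obtain ⟨b, rfl⟩ := Q.cyclic x
  rw [← Module.End.mul_apply, ← map_mul]
  refine (sq_le_sq₀ (norm_nonneg _) (by positivity)).1 ?_
  have h := ω.apply_star_mul_self_mul_le a b
  rw [← Q.norm_π_ψ_sq, ← Q.norm_π_ψ_sq] at h
  rw [mul_pow]
  exact_mod_cast h

theorem isEssentiallySelfAdjoint_op {a : A} (ha : IsSelfAdjoint a) :
    IsEssentiallySelfAdjoint (Q.op a) :=
  (Q.isSymmetricOperator_op ha).isEssentiallySelfAdjoint_of_bound (Q.norm_π_le a)

end GNSQuadruple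

theorem NonNormalizedState.norm_apply_le (ω : NonNormalizedState A) (b : A) :
    ‖ω b‖ ≤ ‖ω 1‖ * ‖b‖ := by
  let Q := ω.gnsQuadruple
  have hψ : ‖ω 1‖ = ‖(Q.ψ : ω.GNSSpace)‖ ^ 2 := by
    simpa using congrArg norm (Q.norm_π_ψ_sq 1).symm
  calc ‖ω b‖ ≤ ‖(Q.ψ : ω.GNSSpace)‖ * ‖(Q.π b Q.ψ : ω.GNSSpace)‖ := by
        rw [Q.expectation]
        exact norm_inner_le_norm _ _
    _ ≤ ‖(Q.ψ : ω.GNSSpace)‖ * (‖b‖ * ‖(Q.ψ : ω.GNSSpace)‖) := by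
        gcongr
        exact Q.norm_π_le b Q.ψ
    _ = ‖ω 1‖ * ‖b‖ := by rw [hψ]; ring

namespace SolvesMomentProblem

variable {ω : NonNormalizedState A} {a : A} {μ ν : Measure ℝ}

theorem integral_pow_le (h : SolvesMomentProblem ω a μ) (n : ℕ) :
    ∫ t, t ^ n ∂μ ≤ ‖ω 1‖ * ‖a‖ ^ n := by
  have := ω.nontrivial
  calc ∫ t, t ^ n ∂μ ≤ ‖((∫ t, t ^ n ∂μ : ℝ) : ℂ)‖ := by
        rw [Complex.norm_real]
        exact Real.le_norm_self _
    _ = ‖ω (a ^ n)‖ := by rw [h.moment]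
    _ ≤ ‖ω 1‖ * ‖a ^ n‖ := ω.norm_apply_le _
    _ ≤ ‖ω 1‖ * ‖a‖ ^ n := by
        gcongr
        exact norm_pow_le a n

theorem integrableExpSet_eq_univ (h : SolvesMomentProblem ω a μ) :
    ProbabilityTheory.integrableExpSet id μ = Set.univ := by
  have := h.isFiniteMeasure
  exact integrableExpSet_eq_univ_of_integral_pow_le (fun n => h.integrable (2 * n))
    (norm_nonneg a) fun n => h.integral_pow_le (2 * n)

theorem unique (hμ : SolvesMomentProblem ω a μ) (hν : SolvesMomentProblem ω a ν) : μ = ν := by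
  have := hμ.isFiniteMeasure
  have := hν.isFiniteMeasure
  refine eq_of_integral_pow_eq (by simp [hμ.integrableExpSet_eq_univ])
    (by simp [hν.integrableExpSet_eq_univ]) fun n => Complex.ofReal_injective ?_
  rw [← hμ.moment, ← hν.moment]

end SolvesMomentProblem

end CStar

theorem proposition2p4 :
    -- (a) unital `*`-algebras
    (∀ (A : Type u) [Ring A] [StarRing A] [Algebra ℂ A] [StarModule ℂ A]
      (ω : NonNormalizedState A) (a : A) (_ha : IsSelfAdjoint a)
      (H : Type v) [NormedAddCommGroup H] [InnerProductSpace ℂ H] [CompleteSpace H]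
      (Q : GNSQuadruple ω H) (_hQ : IsEssentiallySelfAdjoint (Q.op a)),
      (∃ P : PVM H, P.IsSpectralMeasureOf (Q.op a).closure) ∧
      ∀ P : PVM H, P.IsSpectralMeasureOf (Q.op a).closure →
        IsFiniteMeasure (P.measure Q.ψ) ∧ SolvesMomentProblem ω a (P.measure Q.ψ)) ∧
    -- (b) unital C*-algebras
    (∀ (A : Type u) [CStarAlgebra A]
      (ω : NonNormalizedState A) (a : A) (_ha : IsSelfAdjoint a)
      (H : Type v) [NormedAddCommGroup H] [InnerProductSpace ℂ H] [CompleteSpace H]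
      (Q : GNSQuadruple ω H),
      IsEssentiallySelfAdjoint (Q.op a) ∧
      ∃ P : PVM H, P.IsSpectralMeasureOf (Q.op a).closure ∧
        ∀ μ : Measure ℝ, SolvesMomentProblem ω a μ ↔ μ = P.measure Q.ψ) := by
  refine ⟨?_, ?_⟩
  · intro A _ _ _ _ ω a _ H _ _ _ Q hQ
    exact ⟨exists_isSpectralMeasureOf hQ.closure_selfAdjoint, fun P hP =>
      ⟨inferInstance, Q.solvesMomentProblem hQ hP⟩⟩
  · intro A _ ω a ha H _ _ _ Q
    have hQ := Q.isEssentiallySelfAdjoint_op ha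
    obtain ⟨P, hP⟩ := exists_isSpectralMeasureOf hQ.closure_selfAdjoint
    have hsol := Q.solvesMomentProblem hQ hP
    refine ⟨hQ, P, hP, fun μ => ⟨fun hμ => hμ.unique hsol, ?_⟩⟩
    rintro rfl
    exact hsol
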